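/- **Information systems with witnesses.** Let $A$ be a set, $\Delta\in A$, $\mathrm{Con}$ a relation between elements (tokens) of $A$ and finite subsets of $A$ (write $X\in\mathrm{Con}(i)$ for $(i,X)\in\mathrm{Con}$), and ${\vdash}\subseteq \mathrm{Con}\times A$. Write $(i,X)\vdash Y$ if $(i,X)\vdash c$ for all $c\in Y$, and $(i,X)\vdash(j,Y)$ if $(i,X)\vdash j$ and $(i,X)\vdash Y$. $(A,\mathrm{Con},\vdash,\Delta)$ is an *information system with witnesses* if for all $i,j,a\in A$ and finite $X,Y\subseteq A$: (1) $\{i\}\in\mathrm{Con}(i)$; (2) $Y\subseteq X\in\mathrm{Con}(i)\Rightarrow Y\in\mathrm{Con}(i)$; (3) $(i,\emptyset)\vdash\Delta$; (4) $X\in\mathrm{Con}(i)$, $(i,X)\vdash Y\Rightarrow Y\in\mathrm{Con}(i)$; (5) $X,Y\in\mathrm{Con}(i)$, $X\subseteq Y$, $(i,X)\vdash a\Rightarrow(i,Y)\vdash a$; (6) $X\in\mathrm{Con}(i)$, $(i,X)\vdash Y$, $(i,Y)\vdash a\Rightarrow(i,X)\vdash a$; (7) $(i,X)\vdash a\Rightarrow$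 there is $Z\in\mathrm{Con}(i)$ with $(i,X)\vdash Z$ and $(i,Z)\vdash a$; (8) $X\in\mathrm{Con}(i)$, $(i,X)\vdash Y\Rightarrow$ there is $e\in A$ with $(i,X)\vdash e$ and $Y\in\mathrm{Con}(e)$; (9) if $\{i\}\in\mathrm{Con}(j)$, then $\mathrm{Con}(i)\subseteq\mathrm{Con}(j)$, and for $X\in\mathrm{Con}(i)$: $(i,X)\vdash a\Leftrightarrow(j,X)\vdash a$. A *state* is a set $x\subseteq A$ such that every finite $F\subseteq x$ is in $\mathrm{Con}(i)$ for some $i\in x$; if $i\in x$, $X\subseteq x$, $X\in\mathrm{Con}(i)$ and $(i,X)\vdash a$, then $a\in x$; and for every $a\in x$ there are $i\in x$ and $X\subseteq x$ with $X\in\mathrm{Con}(i)$ and $(i,X)\vdash a$. $|A|$ is the set of states ordered by inclusion, and $[X]_i=\{a\mid(i,X)\vdash a\}$, a state for $(i,X)\in\mathrm{Con}$. A *domain* is a directed-complete partial order with a basis: a subset $B$ such that each $x$ is the least upper bound of a directed (nonempty) set of elements of $B$ approximating $x$ ($u\ll x$). $[D\to D']$ is the set of Scott continuous functions with the pointwise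 order. **Auxiliary notions.** Let $A$, $A'$ be information systems with witnesses; primes refer to $A'$. Write $i\sim j\,[X]$ if there are $n\ge1$ and $a_0=i,\dots,a_n=j$, $k_1,\dots,k_n$ with $X\in\mathrm{Con}(a_{\nu-1})\cap\mathrm{Con}(a_\nu)$ and $\{a_{\nu-1}\},\{a_\nu\}\in\mathrm{Con}(k_\nu)$ for $1\le\nu\le n$. For a set $\mathfrak X$ of pairs $(i,X)\in\mathrm{Con}$ put $\bigcup\mathrm{pr}_2\mathfrak X=\bigcup_{(i,X)\in\mathfrak X}X$ and $W(\mathfrak X)=\{a\mid\bigcup\mathrm{pr}_2\mathfrak X\in\mathrm{Con}(a),\ a\sim i\,[X]\text{ for all }(i,X)\in\mathfrak X\}$. For $\mathfrak V\subseteq\mathrm{Con}\times A'$ finite and $(a,S)\in\mathrm{Con}$ let $$\mathrm{Cl}(a,S)=\{(i,X)\in\mathrm{pr}_1\mathfrak V\mid\exists j\ (i\sim j\,[X],\ (a,S)\vdash(j,X))\},\qquad \mathrm{ap}((a,S),\mathfrak V)=\{c\mid\exists p\in\mathrm{Cl}(a,S)\ (p,c)\in\mathfrak V\},$$ $\mathrm{sp}((a,S),\mathfrak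 V)=\{((i,X),c)\in\mathfrak V\mid a\sim i\,[X],\ X\subseteq S\}$, and let $\mathrm{ds}((a,S),\mathfrak V)$ and $\mathrm{rs}((a,S),\mathfrak V)$ be its first and second projections. For $\mathfrak J\subseteq\mathfrak V$ put $T_{\mathfrak J}=\bigcup\mathrm{pr}_2(\mathrm{pr}_1\mathfrak J)$. For $a\in W(\mathrm{pr}_1\mathfrak J)$, $(a,\mathfrak J)$ is *$\mathfrak V$-maximal* if every $((i,X),c)\in\mathfrak V$ with $X\subseteq T_{\mathfrak J}$ and $a\sim i\,[X]$ belongs to $\mathfrak J$. $\mathfrak W\subseteq\mathrm{Con}\times A'$ is an *associate* of $\mathfrak V$ if there are systems of representatives $R(\mathrm{pr}_1\mathfrak J)$ of $W(\mathrm{pr}_1\mathfrak J)$ modulo $\sim[T_{\mathfrak J}]$ for $\mathfrak J\subseteq\mathfrak V$ (depending only on $\mathrm{pr}_1\mathfrak J$), with $R(\emptyset)=\{\Delta\}$ and $R(\{(i,X)\})=\{i\}$ for $(i,X)\in\mathrm{pr}_1\mathfrak V$, and sets $\mathfrak W^{(\kappa)}$ $(\kappa\ge0)$, $\widehat{\mathfrak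 W}^{(\kappa)}$ $(\kappa\ge1)$ such that $\mathfrak W=\bigcup_\kappa\mathfrak W^{(\kappa)}$; $\mathfrak W^{(0)}$ is $\{((\Delta,\emptyset),\Delta')\}$ if $(\Delta,\emptyset)$ is $\mathfrak V$-maximal and $\emptyset$ otherwise; $\mathfrak W^{(\kappa)}=\mathfrak W^{(\kappa-1)}\cup\widehat{\mathfrak W}^{(\kappa)}$ for $\kappa\ge1$; and, for $\kappa\ge1$: (i) for all $\mathfrak J\subseteq\mathfrak V$ with $\kappa$ elements and all $e\in R(\mathrm{pr}_1\mathfrak J)$ with $(e,\mathfrak J)$ $\mathfrak V$-maximal there is exactly one $j\in A'$ with $((e,T_{\mathfrak J}),j)\in\widehat{\mathfrak W}^{(\kappa)}$ and $$(*)\quad\Bigl\{t\Bigm|\exists a\in A\ \exists\mathfrak K\subseteq\mathfrak V:\ T_{\mathfrak K}\subseteq T_{\mathfrak J},\ a\sim e\,[T_{\mathfrak K}],\ \bigl(|\mathfrak K|=1\wedge((a,T_{\mathfrak K}),t)\in\mathfrak V\bigr)\vee\bigl(a\in R(\mathrm{pr}_1\mathfrak K)\wedge((a,T_{\mathfrak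 K}),t)\in\mathfrak W^{(\kappa-1)}\bigr)\Bigr\}\in\mathrm{Con}'(j);$$ (ii) for each $((a,T),b)\in\widehat{\mathfrak W}^{(\kappa)}$ there is $\mathfrak J\subseteq\mathfrak V$ with $\kappa$ elements such that $a\in R(\mathrm{pr}_1\mathfrak J)$, $(a,\mathfrak J)$ is $\mathfrak V$-maximal, $T=T_{\mathfrak J}$, and $(*)$ holds with $e=a$, $j=b$. For $(a,S)\in\mathrm{Con}$ there is then exactly one $((e,T),j)\in\mathfrak W$ with $T=\bigcup\mathrm{pr}_2\mathrm{Cl}(a,S)$, $e\in W(\mathrm{Cl}(a,S))$, $a\sim e\,[T]$ and $\mathrm{ap}((a,S),\mathfrak V)\in\mathrm{Con}'(j)$; put $\mathfrak W_2(a,S)=j$. **Function space.** The tokens of $A\to A'$ are the pairs $\langle\mathfrak W|\mathfrak V\rangle$ with $\mathfrak V\subseteq\mathrm{Con}\times A'$ finite and $\mathfrak W$ an associate of $\mathfrak V$. For a set $\mathcal T$ of tokens, $\bigcup\mathrm{pr}_2\mathcal T$ is the union of their second components. A finite set $\mathcal T$ is in $\mathrm{Con}_\to(\langle\mathfrak W|\mathfrak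 V\rangle)$ if for all $(a,S)\in\mathrm{Con}$: for each $\langle\mathfrak G|\mathfrak F\rangle\in\mathcal T$ there is $k$ with $\mathfrak G_2(a,S)\sim k\,[\mathrm{ap}((a,S),\mathfrak F)]$ and $\{k\}\in\mathrm{Con}'(\mathfrak W_2(a,S))$; and for all $r\in A'$, $r\sim\mathfrak W_2(a,S)\,[\mathrm{ap}((a,S),\mathfrak V)]$ implies $r\sim\mathfrak W_2(a,S)\,[\mathrm{ap}((a,S),\bigcup\mathrm{pr}_2\mathcal T)]$. For $\mathcal T\in\mathrm{Con}_\to(\langle\mathfrak W|\mathfrak V\rangle)$, $(\langle\mathfrak W|\mathfrak V\rangle,\mathcal T)\vdash_\to\langle\mathfrak B|\mathfrak A\rangle$ if $(\mathfrak W_2(e,Y),\mathrm{ap}((e,Y),\bigcup\mathrm{pr}_2\mathcal T))\vdash'f$ for all $((e,Y),f)\in\mathfrak A$, and for all $((a,Z),b)\in\mathfrak B$ there is $k$ with $b\sim k\,[\mathrm{rs}((a,Z),\mathfrak A)]$ and $$\Bigl(\mathfrak W_2(a,Z),\bigcup\{\mathrm{ap}((e,Y),\textstyle\bigcup\mathrm{pr}_2\mathcal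 T)\mid(e,Y)\in\mathrm{ds}((a,Z),\mathfrak A)\}\Bigr)\vdash'(k,\mathrm{rs}((a,Z),\mathfrak A)).$$ Finally $\Delta_\to=\langle\{((\Delta,\emptyset),\Delta')\}|\emptyset\rangle$. For $f\in|A\to A'|$ and $x\in|A|$ let $$\mathrm{fct}(f)(x)=\{b\in A'\mid\exists(i,X)\in\mathrm{Con}:\ \{i\}\cup X\subseteq x,\ ((i,X),b)\in\textstyle\bigcup\mathrm{pr}_2 f\}.$$ For $g\in[|A|\to|A'|]$ let $H^g=\{((i,X),b)\mid (i,X)\in\mathrm{Con},\ b\in g([X]_i)\}$ and let $\mathrm{st}(g)$ be the set of all tokens $\langle\mathfrak B|\mathfrak A\rangle$ of $A\to A'$ with $\mathfrak A\subseteq H^g$ such that for each $((a,Z),b)\in\mathfrak B$ there is $j$ with $((a,Z),j)\in H^g$ and $j\sim b\,[\mathrm{rs}((a,Z),\mathfrak A)]$. **Proposition.** Let $(A,\mathrm{Con},\vdash,\Delta)$ and $(A',\mathrm{Con}',\vdash',\Delta')$ be information systems with witnesses. Then $(A\to A',\mathrm{Con}_\to,\vdash_\to,\Delta_\to)$ is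 an information system with witnesses, $|A\to A'|$ and $[|A|\to|A'|]$ are domains, and these domains are isomorphic: $\mathrm{fct}$ is an order isomorphism from $|A\to A'|$ onto $[|A|\to|A'|]$ with inverse $\mathrm{st}$, and both maps are Scott continuous. -/

import Mathlib

universe u v

/-! # Order-theoretic notions -/

section Domains

/-- `x ≪ y`: every directed set whose least upper bound exists and lies above `y`
has an element above `x`. -/
def Approximates {D : Type u} [PartialOrder D] (x y : D) : Prop :=
  ∀ S : Set D, S.Nonempty → DirectedOn (· ≤ ·) S → ∀ s : D, IsLUB S s → y ≤ s → ∃ u ∈ S, x ≤ u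

/-- `B` is a basis: each `x` is the least upper bound of a directed set of elements of `B`
that approximate `x`. -/
def IsDomainBasis {D : Type u} [PartialOrder D] (B : Set D) : Prop :=
  ∀ x : D, ∃ S : Set D, S ⊆ {b | b ∈ B ∧ Approximates b x} ∧ S.Nonempty ∧
    DirectedOn (· ≤ ·) S ∧ IsLUB S x

/-- A (continuous) domain: a directed-complete partial order that has a basis. -/
structure IsContinuousDomain (D : Type u) [PartialOrder D] : Prop where
  directedComplete : ∀ S : Set D, S.Nonempty → DirectedOn (· ≤ ·) S → ∃ s : D, IsLUB S s
  hasBasis : ∃ B : Set D, IsDomainBasis B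

/-- The Scott continuous functions from `D` to `D'`, ordered pointwise. -/
abbrev ScottMap (D : Type u) (D' : Type v) [PartialOrder D] [PartialOrder D'] : Type (max u v) :=
  {g : D → D' // ScottContinuous g}

end Domains

/-! # Information systems with witnesses -/

/-- The data of an information system: `Con i X` says that the finite set `X` is consistent with
witness `i`, `Ent i X a` is the entailment `(i, X) ⊢ a`, and `truth` is the distinguished token. -/
structure InfoFrame (A : Type u) where
  Con : A → Set A → Prop
  Ent : A → Set A → A → Prop
  truth : A

namespace InfoFrame

variable {A : Type u} {A' : Type v}

/-- `(i, X) ⊢ Y` for a set `Y`. -/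
def EntSet (𝒜 : InfoFrame A) (i : A) (X Y : Set A) : Prop := ∀ c ∈ Y, 𝒜.Ent i X c

/-- `(i, X) ⊢ (j, Y)`. -/
def EntPair (𝒜 : InfoFrame A) (i : A) (X : Set A) (j : A) (Y : Set A) : Prop :=
  𝒜.Ent i X j ∧ 𝒜.EntSet i X Y

/-- The axioms of an information system with witnesses. The first two fields say that `Con` is a
relation between tokens and finite sets and that entailment is a relation between `Con` and
tokens. -/
structure IsInfoSys (𝒜 : InfoFrame A) : Prop where
  finite_of_con : ∀ {i X}, 𝒜.Con i X → X.Finite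
  con_of_ent : ∀ {i X a}, 𝒜.Ent i X a → 𝒜.Con i X
  con_self : ∀ i, 𝒜.Con i {i}
  con_mono : ∀ {i X Y}, Y ⊆ X → 𝒜.Con i X → 𝒜.Con i Y
  ent_truth : ∀ i, 𝒜.Ent i ∅ 𝒜.truth
  con_of_entSet : ∀ {i X Y}, Y.Finite → 𝒜.Con i X → 𝒜.EntSet i X Y → 𝒜.Con i Y
  ent_mono : ∀ {i X Y a}, 𝒜.Con i X → 𝒜.Con i Y → X ⊆ Y → 𝒜.Ent i X a → 𝒜.Ent i Y a
  ent_trans : ∀ {i X Y a}, Y.Finite → 𝒜.Con i X → 𝒜.EntSet i X Y → 𝒜.Ent i Y a → 𝒜.Ent i X a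
  ent_interpolation : ∀ {i X a}, 𝒜.Ent i X a → ∃ Z, 𝒜.Con i Z ∧ 𝒜.EntSet i X Z ∧ 𝒜.Ent i Z a
  witness_interpolation : ∀ {i X Y}, Y.Finite → 𝒜.Con i X → 𝒜.EntSet i X Y →
    ∃ e, 𝒜.Ent i X e ∧ 𝒜.Con e Y
  con_transfer : ∀ {i j X}, 𝒜.Con j {i} → 𝒜.Con i X → 𝒜.Con j X
  ent_transfer : ∀ {i j X a}, 𝒜.Con j {i} → 𝒜.Con i X → 𝒜.Ent i X a → 𝒜.Ent j X a
  ent_conservative : ∀ {i j X a}, 𝒜.Con j {i} → 𝒜.Con i X → 𝒜.Ent j X a → 𝒜.Ent i X a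

/-- States: finitely consistent, closed under entailment, and every token is derivable. -/
structure IsState (𝒜 : InfoFrame A) (x : Set A) : Prop where
  consistent : ∀ F : Set A, F ⊆ x → F.Finite → ∃ i ∈ x, 𝒜.Con i F
  closed : ∀ i ∈ x, ∀ X : Set A, X ⊆ x → ∀ a, 𝒜.Con i X → 𝒜.Ent i X a → a ∈ x
  derivable : ∀ a ∈ x, ∃ i ∈ x, ∃ X : Set A, X ⊆ x ∧ 𝒜.Con i X ∧ 𝒜.Ent i X a

/-- The poset `|A|` of states, ordered by inclusion. -/
abbrev State (𝒜 : InfoFrame A) : Type u := {x : Set A // 𝒜.IsState x}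

/-- `[X]_i`, the set of tokens entailed by `(i, X)`. -/
def gen (𝒜 : InfoFrame A) (i : A) (X : Set A) : Set A := {a | 𝒜.Ent i X a}

theorem IsInfoSys.isState_gen {𝒜 : InfoFrame A} (h : 𝒜.IsInfoSys) {i : A} {X : Set A}
    (hX : 𝒜.Con i X) : 𝒜.IsState (𝒜.gen i X) where
  consistent F hF hfin := h.witness_interpolation hfin hX hF
  closed j hj Y hY a hc ha := by
    have hji : 𝒜.Con i {j} := by
      refine h.con_of_entSet (Set.finite_singleton j) hX ?_
      rintro c rfl
      exact hj
    exact h.ent_trans (h.finite_of_con hc) hX hY (h.ent_transfer hji hc ha)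
  derivable a ha := by
    obtain ⟨Z, hZ, hXZ, hZa⟩ := h.ent_interpolation ha
    obtain ⟨e, he, heZ⟩ := h.witness_interpolation (h.finite_of_con hZ) hX hXZ
    have hei : 𝒜.Con i {e} := by
      refine h.con_of_entSet (Set.finite_singleton e) hX ?_
      rintro c rfl
      exact he
    exact ⟨e, he, Z, hXZ, heZ, h.ent_conservative hei heZ hZa⟩

/-! # Equivalence of witnesses -/

/-- `i ∼ j [X]`: there is a chain `i = a₀, …, aₙ = j` with `n ≥ 1` such that all `a_ν` witness `X`
and any two consecutive members of it have a common witness `k`. Thus `i ∼ i [X]` holds exactly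
if `X` is consistent with witness `i`. -/
def WitEq (𝒜 : InfoFrame A) (X : Set A) (i j : A) : Prop :=
  Relation.TransGen
    (fun a b => 𝒜.Con a X ∧ 𝒜.Con b X ∧ ∃ k, 𝒜.Con k {a} ∧ 𝒜.Con k {b}) i j

/-- `Cl((a, S), 𝔛)`. -/
def Cl (𝒜 : InfoFrame A) (a : A) (S : Set A) (𝔛 : Set (A × Set A)) : Set (A × Set A) :=
  {p | p ∈ 𝔛 ∧ ∃ j, 𝒜.WitEq p.2 p.1 j ∧ 𝒜.EntPair a S j p.2}

/-- The union of the second components of a set of pairs `(i, X)`. -/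
def supp (𝔛 : Set (A × Set A)) : Set A := ⋃ p ∈ 𝔛, p.2

/-- `W(𝔛)`, the common witnesses of `𝔛`. -/
def commonWit (𝒜 : InfoFrame A) (𝔛 : Set (A × Set A)) : Set A :=
  {a | 𝒜.Con a (supp 𝔛) ∧ ∀ p ∈ 𝔛, 𝒜.WitEq p.2 a p.1}

/-- `(a, 𝔘)` is `𝔙`-maximal. It is used for `𝔘 ⊆ 𝔙` and common witnesses `a` of `pr₁ 𝔘` only. -/
def IsMaximalIn (𝒜 : InfoFrame A) (𝔙 : Set ((A × Set A) × A')) (a : A)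
    (𝔘 : Set ((A × Set A) × A')) : Prop :=
  ∀ v ∈ 𝔙, v.1.2 ⊆ supp (Prod.fst '' 𝔘) → 𝒜.WitEq v.1.2 a v.1.1 → v ∈ 𝔘

/-- The `𝔙`-spectrum of `(a, S)`. -/
def spectrum (𝒜 : InfoFrame A) (a : A) (S : Set A) (𝔙 : Set ((A × Set A) × A')) :
    Set ((A × Set A) × A') :=
  {v | v ∈ 𝔙 ∧ 𝒜.WitEq v.1.2 a v.1.1 ∧ v.1.2 ⊆ S}

/-- `ds((a, S), 𝔙)`. -/
def ds (𝒜 : InfoFrame A) (a : A) (S : Set A) (𝔙 : Set ((A × Set A) × A')) : Set (A × Set A) :=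
  Prod.fst '' 𝒜.spectrum a S 𝔙

/-- `rs((a, S), 𝔙)`. -/
def rs (𝒜 : InfoFrame A) (a : A) (S : Set A) (𝔙 : Set ((A × Set A) × A')) : Set A' :=
  Prod.snd '' 𝒜.spectrum a S 𝔙

/-- `ap((a, S), 𝔙)`. -/
def ap (𝒜 : InfoFrame A) (a : A) (S : Set A) (𝔙 : Set ((A × Set A) × A')) : Set A' :=
  {c | ∃ p ∈ 𝒜.Cl a S (Prod.fst '' 𝔙), (p, c) ∈ 𝔙}

/-! # Associates -/

/-- `R` is a choice of systems of representatives: for `𝔍 ⊆ 𝔙`, the set `R (pr₁ 𝔍)` contains exactly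
one member of each class of `W(pr₁ 𝔍)` modulo `∼ [⋃ pr₂ (pr₁ 𝔍)]`; moreover `R(∅)` is `{Δ}` and
`R({(i, X)})` is `{i}`. -/
structure IsRepChoice (𝒜 : InfoFrame A) (𝔙 : Set ((A × Set A) × A'))
    (R : Set (A × Set A) → Set A) : Prop where
  subset : ∀ 𝔍 ⊆ 𝔙, R (Prod.fst '' 𝔍) ⊆ 𝒜.commonWit (Prod.fst '' 𝔍)
  existsUnique : ∀ 𝔍 ⊆ 𝔙, ∀ a ∈ 𝒜.commonWit (Prod.fst '' 𝔍),
    ∃! e, e ∈ R (Prod.fst '' 𝔍) ∧ 𝒜.WitEq (supp (Prod.fst '' 𝔍)) a e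
  empty : R ∅ = {𝒜.truth}
  singleton : ∀ v ∈ 𝔙, R {v.1} = {v.1.1}

/-- The set of tokens that the witness chosen for `(e, 𝔍)` has to witness, where `𝔓` is the
preceding stage of the construction of the associate. -/
def toWitness (𝒜 : InfoFrame A) (𝔙 : Set ((A × Set A) × A')) (R : Set (A × Set A) → Set A)
    (𝔓 : Set ((A × Set A) × A')) (e : A) (𝔍 : Set ((A × Set A) × A')) : Set A' :=
  {t | ∃ a : A, ∃ 𝔎 ⊆ 𝔙, supp (Prod.fst '' 𝔎) ⊆ supp (Prod.fst '' 𝔍) ∧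
    𝒜.WitEq (supp (Prod.fst '' 𝔎)) a e ∧
    ((𝔎.ncard = 1 ∧ ((a, supp (Prod.fst '' 𝔎)), t) ∈ 𝔙) ∨
      (a ∈ R (Prod.fst '' 𝔎) ∧ ((a, supp (Prod.fst '' 𝔎)), t) ∈ 𝔓))}

/-- `𝔚` is an associate of the finite set `𝔙`. Subsets `J` of the index set of an enumeration of
`𝔙` without repetitions are represented by the corresponding subsets `𝔍` of `𝔙`;
`stage κ` and `new κ` are the sets `𝔚^(κ)` and `𝔚̂^(κ)`. -/
def IsAssociate (𝒜 : InfoFrame A) (𝒜' : InfoFrame A') (𝔙 𝔚 : Set ((A × Set A) × A')) : Prop :=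
  ∃ R : Set (A × Set A) → Set A, 𝒜.IsRepChoice 𝔙 R ∧
  ∃ stage new : ℕ → Set ((A × Set A) × A'),
    𝔚 = ⋃ κ, stage κ ∧
    stage 0 = {m | m = ((𝒜.truth, ∅), 𝒜'.truth) ∧ 𝒜.IsMaximalIn 𝔙 𝒜.truth ∅} ∧
    ∀ κ : ℕ, stage (κ + 1) = stage κ ∪ new (κ + 1) ∧
      (∀ 𝔍 ⊆ 𝔙, 𝔍.ncard = κ + 1 → ∀ e ∈ R (Prod.fst '' 𝔍), 𝒜.IsMaximalIn 𝔙 e 𝔍 →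
        ∃! j : A', 𝒜'.Con j (𝒜.toWitness 𝔙 R (stage κ) e 𝔍) ∧
          ((e, supp (Prod.fst '' 𝔍)), j) ∈ new (κ + 1)) ∧
      (∀ a T b, ((a, T), b) ∈ new (κ + 1) → ∃ 𝔍 ⊆ 𝔙, a ∈ R (Prod.fst '' 𝔍) ∧
        𝔍.ncard = κ + 1 ∧ 𝒜.IsMaximalIn 𝔙 a 𝔍 ∧ T = supp (Prod.fst '' 𝔍) ∧
        𝒜'.Con b (𝒜.toWitness 𝔙 R (stage κ) a 𝔍))

/-! # The function space -/

/-- The tokens `⟨𝔚 | 𝔙⟩` of `A → A'`: a finite set `𝔙 ⊆ Con × A'` together with an associate `𝔚`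
of `𝔙`. -/
@[ext]
structure FunToken (𝒜 : InfoFrame A) (𝒜' : InfoFrame A') where
  assoc : Set ((A × Set A) × A')
  base : Set ((A × Set A) × A')
  base_finite : base.Finite
  base_con : ∀ v ∈ base, 𝒜.Con v.1.1 v.1.2
  isAssociate : IsAssociate 𝒜 𝒜' base assoc

/-- `((e, T), j)` is the element `𝔚(a, S)` of `𝔚`. -/
def FunToken.IsValue {𝒜 : InfoFrame A} {𝒜' : InfoFrame A'} (τ : FunToken 𝒜 𝒜') (a : A) (S : Set A)
    (e : A) (T : Set A) (j : A') : Prop :=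
  T = supp (𝒜.Cl a S (Prod.fst '' τ.base)) ∧
    e ∈ 𝒜.commonWit (𝒜.Cl a S (Prod.fst '' τ.base)) ∧ 𝒜.WitEq T a e ∧
    𝒜'.Con j (𝒜.ap a S τ.base) ∧ ((e, T), j) ∈ τ.assoc

open Classical in
/-- `𝔚₂(a, S)`, the last component of the unique element `𝔚(a, S)` of `𝔚`. -/
noncomputable def FunToken.wit {𝒜 : InfoFrame A} {𝒜' : InfoFrame A'} (τ : FunToken 𝒜 𝒜')
    (a : A) (S : Set A) : A' :=
  if h : ∃ j e T, τ.IsValue a S e T j then h.choose else 𝒜'.truth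

/-- The union of the second components of a set of tokens `⟨𝔚 | 𝔙⟩`. -/
def baseUnion {𝒜 : InfoFrame A} {𝒜' : InfoFrame A'} (𝒯 : Set (FunToken 𝒜 𝒜')) :
    Set ((A × Set A) × A') :=
  ⋃ σ ∈ 𝒯, σ.base

/-- The consistency predicate of the function space. -/
def FunCon (𝒜 : InfoFrame A) (𝒜' : InfoFrame A') (τ : FunToken 𝒜 𝒜')
    (𝒯 : Set (FunToken 𝒜 𝒜')) : Prop :=
  𝒯.Finite ∧ ∀ a S, 𝒜.Con a S →
    (∀ σ ∈ 𝒯, ∃ k, 𝒜'.WitEq (𝒜.ap a S σ.base) (σ.wit a S) k ∧ 𝒜'.Con (τ.wit a S) {k}) ∧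
    (∀ r, 𝒜'.WitEq (𝒜.ap a S τ.base) r (τ.wit a S) →
      𝒜'.WitEq (𝒜.ap a S (baseUnion 𝒯)) r (τ.wit a S))

/-- The entailment relation of the function space. -/
def FunEnt (𝒜 : InfoFrame A) (𝒜' : InfoFrame A') (τ : FunToken 𝒜 𝒜')
    (𝒯 : Set (FunToken 𝒜 𝒜')) (β : FunToken 𝒜 𝒜') : Prop :=
  FunCon 𝒜 𝒜' τ 𝒯 ∧
    (∀ e Y f, ((e, Y), f) ∈ β.base →
      𝒜'.Ent (τ.wit e Y) (𝒜.ap e Y (baseUnion 𝒯)) f) ∧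
    (∀ a Z b, ((a, Z), b) ∈ β.assoc → ∃ k, 𝒜'.WitEq (𝒜.rs a Z β.base) b k ∧
      𝒜'.EntPair (τ.wit a Z) (⋃ p ∈ 𝒜.ds a Z β.base, 𝒜.ap p.1 p.2 (baseUnion 𝒯))
        k (𝒜.rs a Z β.base))

theorem IsInfoSys.con_empty {𝒜 : InfoFrame A} (h : 𝒜.IsInfoSys) (a : A) : 𝒜.Con a ∅ :=
  h.con_mono (Set.empty_subset _) (h.con_self a)

theorem IsInfoSys.witEq_truth {𝒜 : InfoFrame A} (h : 𝒜.IsInfoSys) (a : A) :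
    𝒜.WitEq ∅ a 𝒜.truth := by
  refine Relation.TransGen.single ⟨h.con_empty a, h.con_empty _, a, h.con_self a, ?_⟩
  refine h.con_of_entSet (Set.finite_singleton _) (h.con_empty a) ?_
  rintro c rfl
  exact h.ent_truth a

theorem IsInfoSys.isAssociate_empty {𝒜 : InfoFrame A} (h : 𝒜.IsInfoSys) (𝒜' : InfoFrame A') :
    IsAssociate 𝒜 𝒜' ∅ {((𝒜.truth, ∅), 𝒜'.truth)} := by
  refine ⟨fun _ => {𝒜.truth}, ⟨?_, ?_, rfl, fun v hv => hv.elim⟩,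
    fun _ => {((𝒜.truth, ∅), 𝒜'.truth)}, fun _ => ∅, ?_, ?_, fun κ => ⟨?_, ?_, ?_⟩⟩
  · rintro 𝔍 h𝔍 a rfl
    obtain rfl := Set.subset_empty_iff.1 h𝔍
    simp [commonWit, supp, h.con_empty]
  · intro 𝔍 h𝔍 a _
    obtain rfl := Set.subset_empty_iff.1 h𝔍
    refine ⟨𝒜.truth, ⟨rfl, ?_⟩, fun e he => he.1⟩
    simpa [supp] using h.witEq_truth a
  · simp
  · ext m
    simp [IsMaximalIn]
  · simp
  · intro 𝔍 h𝔍 hc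
    obtain rfl := Set.subset_empty_iff.1 h𝔍
    simp at hc
  · intro a T b hb
    exact hb.elim

/-- The function space `A → A'`, with distinguished token `⟨{((Δ, ∅), Δ')} | ∅⟩`. -/
def funSpace {𝒜 : InfoFrame A} (h : 𝒜.IsInfoSys) (𝒜' : InfoFrame A') :
    InfoFrame (FunToken 𝒜 𝒜') where
  Con := FunCon 𝒜 𝒜'
  Ent := FunEnt 𝒜 𝒜'
  truth :=
    { assoc := {((𝒜.truth, ∅), 𝒜'.truth)}
      base := ∅
      base_finite := Set.finite_empty
      base_con := fun _ hv => hv.elim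
      isAssociate := h.isAssociate_empty 𝒜' }

/-! # The maps between states of the function space and Scott continuous functions -/

/-- The relation `am(f) = ⋃ pr₂(f)` between `Con` and `A'`. -/
def am {𝒜 : InfoFrame A} {𝒜' : InfoFrame A'} (f : Set (FunToken 𝒜 𝒜')) :
    Set ((A × Set A) × A') :=
  baseUnion f

/-- The set `St(H)` of tokens of the function space for a relation `H` between `Con` and `A'`. -/
def St (𝒜 : InfoFrame A) (𝒜' : InfoFrame A') (H : Set ((A × Set A) × A')) :
    Set (FunToken 𝒜 𝒜') :=
  {β | β.base ⊆ H ∧ ∀ a Z b, ((a, Z), b) ∈ β.assoc →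
    ∃ j, ((a, Z), j) ∈ H ∧ 𝒜'.WitEq (𝒜.rs a Z β.base) j b}

/-- `ℒ(G)(x)`. -/
def applyRel (𝒜 : InfoFrame A) (G : Set ((A × Set A) × A')) (x : Set A) : Set A' :=
  {b | ∃ i X, 𝒜.Con i X ∧ insert i X ⊆ x ∧ ((i, X), b) ∈ G}

/-- `fct(f)(x) = ℒ(am(f))(x)`. -/
def fct {𝒜 : InfoFrame A} {𝒜' : InfoFrame A'} (f : Set (FunToken 𝒜 𝒜')) (x : Set A) : Set A' :=
  𝒜.applyRel (am f) x

/-- The relation `H^g`: `(i, X) H^g b` if `b ∈ g([X]_i)`. -/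
def relOf {𝒜 : InfoFrame A} (h : 𝒜.IsInfoSys) {𝒜' : InfoFrame A'} (g : 𝒜.State → 𝒜'.State) :
    Set ((A × Set A) × A') :=
  {p | ∃ hX : 𝒜.Con p.1.1 p.1.2, p.2 ∈ (g ⟨𝒜.gen p.1.1 p.1.2, h.isState_gen hX⟩).1}

/-- `st(g) = St(H^g)`. -/
def st {𝒜 : InfoFrame A} (h : 𝒜.IsInfoSys) {𝒜' : InfoFrame A'} (g : 𝒜.State → 𝒜'.State) :
    Set (FunToken 𝒜 𝒜') :=
  St 𝒜 𝒜' (relOf h g)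

end InfoFrame

/-!
The proof passes through approximable relations `H` between `Con` and `A'` (`IsApproximable`): the
relations that grow along the comparison `IsBelow` of consistent pairs, whose fibres
`{t | ((a, S), t) ∈ H}` are states of `A'`, and that are interpolative in `(a, S)`. On one side they
correspond to Scott continuous functions, by `H = H^g` and `g = ℒ(H)` (`isApproximable_relOf`,
`applyRel_relOf`, `IsApproximable.relOf_applyRel`), since each state of `A` is the directed union of
the states `[X]_i` inside it. On the other side they correspond to the states of `A → A'`, by
`f = St(H)` and `H = am(f)` (`IsApproximable.isState_St`, `isApproximable_am`,
`IsApproximable.am_St`, `St_am`). The composite of the two correspondences is given by `fct`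
and `st`.

Two facts about associates carry the function space side. First, the values `𝔚₂(a, S)` grow with the
closure `Cl(a, S)` (`FunToken.con_wit_singleton`): a maximal `𝔍` is the spectrum of its witness and
its support, hence each pair `(e, T)` occurs with exactly one value, and for a larger `𝔍` the
smaller values are among the tokens that have to be witnessed. Second, a finite subset of an
approximable relation `H` has an associate inside `H` (`IsApproximable.exists_token`): at each
stage only finitely many tokens of one fibre have to be witnessed, and the fibre, being a state,
contains a witness for them.

The witnesses `k` in the definitions of consistency and entailment can be eliminated: `FunCon` says
that values are equivalent to the value of `τ` (`funCon_iff`), and `(τ, 𝒯) ⊢ β` says that `β` lies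
in `St(graphOf τ 𝒯)`, where `graphOf τ 𝒯` is the approximable relation
`(𝔚₂(a, S), ap((a, S), ⋃ pr₂ 𝒯)) ⊢ t` (`funEnt_iff`). The interpolation axioms of the function
space are then the statement that `St(H)` is finitely consistent and derivable for
`H = graphOf τ 𝒯`, and the remaining axioms compare graphs. Finally, the states of any information
system with witnesses form a continuous domain (`IsInfoSys.isContinuousDomain`), and this transfers
along the isomorphism.
-/

namespace InfoFrame

variable {A : Type u} {A' : Type v} {𝒜 : InfoFrame A} {𝒜' : InfoFrame A'}

/-! ### Equivalence of witnesses -/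

theorem WitEq.symm {X : Set A} {i j : A} (w : 𝒜.WitEq X i j) : 𝒜.WitEq X j i := by
  induction w with
  | single hb =>
    obtain ⟨h1, h2, k, hk1, hk2⟩ := hb
    exact Relation.TransGen.single ⟨h2, h1, k, hk2, hk1⟩
  | tail _ hb ih =>
    obtain ⟨h1, h2, k, hk1, hk2⟩ := hb
    exact Relation.TransGen.head ⟨h2, h1, k, hk2, hk1⟩ ih

theorem WitEq.trans {X : Set A} {i j k : A} (w : 𝒜.WitEq X i j) (w' : 𝒜.WitEq X j k) :
    𝒜.WitEq X i k :=
  Relation.TransGen.trans w w'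

theorem WitEq.con_right {X : Set A} {i j : A} (w : 𝒜.WitEq X i j) : 𝒜.Con j X := by
  cases w with
  | single hb => exact hb.2.1
  | tail _ hb => exact hb.2.1

theorem WitEq.con_left {X : Set A} {i j : A} (w : 𝒜.WitEq X i j) : 𝒜.Con i X :=
  w.symm.con_right

theorem witEq_of_bound {X : Set A} {i j k : A} (hi : 𝒜.Con i X) (hj : 𝒜.Con j X)
    (hik : 𝒜.Con k {i}) (hjk : 𝒜.Con k {j}) : 𝒜.WitEq X i j :=
  Relation.TransGen.single ⟨hi, hj, k, hik, hjk⟩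

theorem IsInfoSys.witEq_refl (h : 𝒜.IsInfoSys) {X : Set A} {i : A} (hi : 𝒜.Con i X) :
    𝒜.WitEq X i i :=
  witEq_of_bound hi hi (h.con_self i) (h.con_self i)

theorem IsInfoSys.witEq_of_con_singleton (h : 𝒜.IsInfoSys) {X : Set A} {i j : A}
    (hij : 𝒜.Con j {i}) (hi : 𝒜.Con i X) : 𝒜.WitEq X i j :=
  witEq_of_bound hi (h.con_transfer hij hi) hij (h.con_self j)

theorem IsInfoSys.witEq_mono (h : 𝒜.IsInfoSys) {X Y : Set A} (hXY : X ⊆ Y) {i j : A}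
    (w : 𝒜.WitEq Y i j) : 𝒜.WitEq X i j :=
  Relation.TransGen.mono
    (fun _ _ hab => ⟨h.con_mono hXY hab.1, h.con_mono hXY hab.2.1, hab.2.2⟩) i j w

theorem IsInfoSys.ent_of_witEq (h : 𝒜.IsInfoSys) {X : Set A} {i j a : A}
    (w : 𝒜.WitEq X i j) (ha : 𝒜.Ent i X a) : 𝒜.Ent j X a := by
  have step : ∀ {b c : A}, (𝒜.Con b X ∧ 𝒜.Con c X ∧ ∃ k, 𝒜.Con k {b} ∧ 𝒜.Con k {c}) →
      𝒜.Ent b X a → 𝒜.Ent c X a := fun ⟨hb, hc, _, hkb, hkc⟩ hba =>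
    h.ent_conservative hkc hc (h.ent_transfer hkb hb hba)
  induction w with
  | single hb => exact step hb ha
  | tail _ hb ih => exact step hb ih

theorem IsInfoSys.con_singleton_of_ent (h : 𝒜.IsInfoSys) {X : Set A} {i a : A}
    (ha : 𝒜.Ent i X a) : 𝒜.Con i {a} := by
  refine h.con_of_entSet (Set.finite_singleton a) (h.con_of_ent ha) ?_
  rintro c rfl
  exact ha

/-- Witnesses equivalent for a set are equivalent for each finite set entailed by it, since the
members of a chain all entail the same tokens. -/
theorem IsInfoSys.witEq_of_entSet (h : 𝒜.IsInfoSys) {X Y : Set A} (hY : Y.Finite) {i j : A}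
    (w : 𝒜.WitEq X i j) (hXY : 𝒜.EntSet i X Y) : 𝒜.WitEq Y i j := by
  have step : ∀ {b c : A}, 𝒜.WitEq X i b →
      (𝒜.Con b X ∧ 𝒜.Con c X ∧ ∃ k, 𝒜.Con k {b} ∧ 𝒜.Con k {c}) → 𝒜.WitEq Y b c := by
    rintro b c hib ⟨hb, hc, k, hk⟩
    have hib' : 𝒜.WitEq X i c := hib.trans (witEq_of_bound hb hc hk.1 hk.2)
    exact witEq_of_bound
      (h.con_of_entSet hY hb fun t ht => h.ent_of_witEq hib (hXY t ht))
      (h.con_of_entSet hY hc fun t ht => h.ent_of_witEq hib' (hXY t ht)) hk.1 hk.2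
  induction w with
  | single hb => exact step (h.witEq_refl hb.1) hb
  | tail hw hb ih => exact ih.trans (step hw hb)

theorem IsInfoSys.ent_interpolation_finite (h : 𝒜.IsInfoSys) {i : A} {X Y : Set A}
    (hX : 𝒜.Con i X) (hY : Y.Finite) (hXY : 𝒜.EntSet i X Y) :
    ∃ Z, 𝒜.Con i Z ∧ 𝒜.EntSet i X Z ∧ 𝒜.EntSet i Z Y := by
  choose Z hZ hXZ hZY using fun c : Y => h.ent_interpolation (hXY c c.2)
  have : Finite Y := hY
  have hent : 𝒜.EntSet i X (⋃ c, Z c) := by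
    intro t ht
    obtain ⟨c, hc⟩ := Set.mem_iUnion.1 ht
    exact hXZ c t hc
  have hcon : 𝒜.Con i (⋃ c, Z c) :=
    h.con_of_entSet (Set.finite_iUnion fun c => h.finite_of_con (hZ c)) hX hent
  exact ⟨_, hcon, hent, fun c hc =>
    h.ent_mono (hZ ⟨c, hc⟩) hcon (Set.subset_iUnion Z ⟨c, hc⟩) (hZY ⟨c, hc⟩)⟩

/-! ### States -/

theorem IsState.witEq {x : Set A} (hx : 𝒜.IsState x) (h : 𝒜.IsInfoSys) {i j : A} (hi : i ∈ x)
    (hj : j ∈ x) {X : Set A} (hiX : 𝒜.Con i X) (hjX : 𝒜.Con j X) : 𝒜.WitEq X i j := by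
  obtain ⟨k, -, hk⟩ := hx.consistent {i, j} (Set.pair_subset hi hj) (Set.toFinite _)
  exact witEq_of_bound hiX hjX (h.con_mono (by simp) hk) (h.con_mono (by simp) hk)

theorem IsState.truth_mem {x : Set A} (hx : 𝒜.IsState x) (h : 𝒜.IsInfoSys) : 𝒜.truth ∈ x := by
  obtain ⟨i, hi, hc⟩ := hx.consistent ∅ (Set.empty_subset _) Set.finite_empty
  exact hx.closed i hi ∅ (Set.empty_subset _) _ hc (h.ent_truth i)

theorem IsState.gen_subset {x : Set A} (hx : 𝒜.IsState x) (h : 𝒜.IsInfoSys) {i : A} {X : Set A}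
    (hi : i ∈ x) (hX : X ⊆ x) : 𝒜.gen i X ⊆ x :=
  fun a ha => hx.closed i hi X hX a (h.con_of_ent ha) ha

theorem IsInfoSys.gen_subset_gen (h : 𝒜.IsInfoSys) {i j : A} {X Y : Set A}
    (w : 𝒜.WitEq X i j) (hXY : X ⊆ Y) (hY : 𝒜.Con j Y) : 𝒜.gen i X ⊆ 𝒜.gen j Y :=
  fun _ ha => h.ent_mono w.con_right hY hXY (h.ent_of_witEq w ha)

/-- Finitely many tokens of a state are entailed by a consistent pair inside the state. -/
theorem IsState.exists_entSet {x : Set A} (hx : 𝒜.IsState x) (h : 𝒜.IsInfoSys) {F : Set A}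
    (hF : F.Finite) (hFx : F ⊆ x) : ∃ i ∈ x, ∃ X ⊆ x, 𝒜.Con i X ∧ 𝒜.EntSet i X F := by
  choose j hj X hX hc he using fun c : F => hx.derivable c (hFx c.2)
  have : Finite F := hF
  have hfin : (⋃ c, insert (j c) (X c)).Finite :=
    Set.finite_iUnion fun c => (h.finite_of_con (hc c)).insert _
  have hsub : ⋃ c, insert (j c) (X c) ⊆ x :=
    Set.iUnion_subset fun c => Set.insert_subset (hj c) (hX c)
  obtain ⟨k, hk, hkc⟩ := hx.consistent _ hsub hfin
  refine ⟨k, hk, _, hsub, hkc, fun c hcF => ?_⟩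
  have hle : insert (j ⟨c, hcF⟩) (X ⟨c, hcF⟩) ⊆ ⋃ c, insert (j c) (X c) :=
    Set.subset_iUnion (fun c => insert (j c) (X c)) ⟨c, hcF⟩
  have hb : 𝒜.Con k {j ⟨c, hcF⟩} :=
    h.con_mono (Set.singleton_subset_iff.2 (hle (Set.mem_insert _ _))) hkc
  exact h.gen_subset_gen (h.witEq_of_con_singleton hb (hc ⟨c, hcF⟩))
    ((Set.subset_insert _ _).trans hle) hkc (he ⟨c, hcF⟩)

theorem isState_sUnion (𝒮 : Set (Set A)) (hne : 𝒮.Nonempty) (hd : DirectedOn (· ⊆ ·) 𝒮)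
    (hs : ∀ x ∈ 𝒮, 𝒜.IsState x) (h : 𝒜.IsInfoSys) : 𝒜.IsState (⋃₀ 𝒮) where
  consistent F hF hfin := by
    obtain ⟨x, hx, hFx⟩ := hd.exists_mem_subset_of_finite_of_subset_sUnion hne hfin hF
    obtain ⟨i, hi, hc⟩ := (hs x hx).consistent F hFx hfin
    exact ⟨i, ⟨x, hx, hi⟩, hc⟩
  closed i hi X hX a hc ha := by
    obtain ⟨x, hx, hFx⟩ := hd.exists_mem_subset_of_finite_of_subset_sUnion hne
      ((h.finite_of_con hc).insert i) (Set.insert_subset hi hX)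
    exact ⟨x, hx, (hs x hx).closed i (hFx (Set.mem_insert _ _)) X
      ((Set.subset_insert _ _).trans hFx) a hc ha⟩
  derivable a ha := by
    obtain ⟨x, hx, hax⟩ := ha
    obtain ⟨i, hi, X, hX, hc, he⟩ := (hs x hx).derivable a hax
    exact ⟨i, ⟨x, hx, hi⟩, X, hX.trans (Set.subset_sUnion_of_mem hx), hc, he⟩

end InfoFrame

/-! ### Continuous domains -/

theorem Approximates.orderIso {D : Type u} {D' : Type v} [PartialOrder D] [PartialOrder D']
    (e : D ≃o D') {x y : D} (hxy : Approximates x y) : Approximates (e x) (e y) := by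
  intro S hne hd s hs hys
  obtain ⟨_, ⟨t, ht, rfl⟩, hxt⟩ := hxy (e.symm '' S) (hne.image _)
    (hd.mono_comp (fun _ _ hab => e.symm.monotone hab)) (e.symm s) (e.symm.isLUB_image'.2 hs)
    ((e.le_symm_apply).2 hys)
  exact ⟨t, ht, (e.le_symm_apply).1 hxt⟩

theorem IsContinuousDomain.orderIso {D : Type u} {D' : Type v} [PartialOrder D] [PartialOrder D']
    (hD : IsContinuousDomain D) (e : D ≃o D') : IsContinuousDomain D' where
  directedComplete S hne hd := by
    obtain ⟨s, hs⟩ := hD.directedComplete (e.symm '' S) (hne.image _)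
      (hd.mono_comp (fun _ _ hab => e.symm.monotone hab))
    exact ⟨e s, e.symm.isLUB_image.1 hs⟩
  hasBasis := by
    obtain ⟨B, hB⟩ := hD.hasBasis
    refine ⟨e '' B, fun x => ?_⟩
    obtain ⟨S, hSB, hne, hd, hs⟩ := hB (e.symm x)
    refine ⟨e '' S, ?_, hne.image _, hd.mono_comp (fun _ _ hab => e.monotone hab),
      e.isLUB_image.2 hs⟩
    rintro _ ⟨b, hb, rfl⟩
    refine ⟨⟨b, (hSB hb).1, rfl⟩, ?_⟩
    have := (hSB hb).2.orderIso e
    rwa [e.apply_symm_apply] at this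

theorem OrderIso.scottContinuous_coe {D : Type u} {D' : Type v} [PartialOrder D] [PartialOrder D']
    (e : D ≃o D') : ScottContinuous e :=
  fun _ _ _ _ hs => e.isLUB_image'.2 hs

namespace InfoFrame

variable {A : Type u} {A' : Type v} {𝒜 : InfoFrame A} {𝒜' : InfoFrame A'}

/-! ### The domain of states -/

theorem IsInfoSys.isState_sUnion_image (h : 𝒜.IsInfoSys) {S : Set 𝒜.State} (hne : S.Nonempty)
    (hd : DirectedOn (· ≤ ·) S) : 𝒜.IsState (⋃₀ (Subtype.val '' S)) :=
  isState_sUnion _ (hne.image _) (hd.mono_comp fun _ _ hab => hab)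
    (by rintro _ ⟨x, -, rfl⟩; exact x.2) h

theorem IsInfoSys.isLUB_sUnion (h : 𝒜.IsInfoSys) {S : Set 𝒜.State} (hne : S.Nonempty)
    (hd : DirectedOn (· ≤ ·) S) :
    IsLUB S (⟨⋃₀ (Subtype.val '' S), h.isState_sUnion_image hne hd⟩ : 𝒜.State) := by
  constructor
  · intro x hx
    exact Set.subset_sUnion_of_mem (Set.mem_image_of_mem _ hx)
  · intro y hy
    refine Set.sUnion_subset ?_
    rintro _ ⟨x, hx, rfl⟩
    exact hy hx

/-- A directed set of states has its union as least upper bound, and a finite subset of the union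
lies in a member. -/
theorem IsInfoSys.exists_subset_of_isLUB (h : 𝒜.IsInfoSys) {S : Set 𝒜.State} (hne : S.Nonempty)
    (hd : DirectedOn (· ≤ ·) S) {s : 𝒜.State} (hs : IsLUB S s) {F : Set A} (hF : F.Finite)
    (hFs : F ⊆ s.1) : ∃ x ∈ S, F ⊆ x.1 := by
  obtain rfl := hs.unique (h.isLUB_sUnion hne hd)
  obtain ⟨_, ⟨x, hx, rfl⟩, hFx⟩ := DirectedOn.exists_mem_subset_of_finite_of_subset_sUnion
    (hne.image _) (hd.mono_comp (g := Subtype.val) fun _ _ hab => hab) hF hFs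
  exact ⟨x, hx, hFx⟩

/-- The states generated by the consistent pairs inside `x`. -/
def genSet (h : 𝒜.IsInfoSys) (x : Set A) : Set 𝒜.State :=
  {y | ∃ i X, ∃ hX : 𝒜.Con i X, i ∈ x ∧ X ⊆ x ∧ y = ⟨𝒜.gen i X, h.isState_gen hX⟩}

theorem genSet_nonempty (h : 𝒜.IsInfoSys) (x : 𝒜.State) : (genSet h x.1).Nonempty := by
  obtain ⟨i, hi, hc⟩ := x.2.consistent ∅ (Set.empty_subset _) Set.finite_empty
  exact ⟨_, i, ∅, hc, hi, Set.empty_subset _, rfl⟩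

theorem genSet_directed (h : 𝒜.IsInfoSys) (x : 𝒜.State) : DirectedOn (· ≤ ·) (genSet h x.1) := by
  rintro _ ⟨i, X, hX, hi, hXx, rfl⟩ _ ⟨j, Y, hY, hj, hYx, rfl⟩
  obtain ⟨k, hk, hc⟩ := x.2.consistent (insert i X ∪ insert j Y)
    (Set.union_subset (Set.insert_subset hi hXx) (Set.insert_subset hj hYx))
    (((h.finite_of_con hX).insert i).union ((h.finite_of_con hY).insert j))
  have hc' : 𝒜.Con k (X ∪ Y) := h.con_mono
    (Set.union_subset_union (Set.subset_insert _ _) (Set.subset_insert _ _)) hc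
  refine ⟨_, ⟨k, X ∪ Y, hc', hk, Set.union_subset hXx hYx, rfl⟩, ?_, ?_⟩
  · exact h.gen_subset_gen (h.witEq_of_con_singleton (h.con_mono (by simp) hc) hX)
      Set.subset_union_left hc'
  · exact h.gen_subset_gen (h.witEq_of_con_singleton (h.con_mono (by simp) hc) hY)
      Set.subset_union_right hc'

theorem genSet_isLUB (h : 𝒜.IsInfoSys) (x : 𝒜.State) : IsLUB (genSet h x.1) x := by
  constructor
  · rintro _ ⟨i, X, hX, hi, hXx, rfl⟩
    exact x.2.gen_subset h hi hXx
  · intro y hy a ha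
    obtain ⟨i, hi, X, hX, hc, he⟩ := x.2.derivable a ha
    exact hy ⟨i, X, hc, hi, hX, rfl⟩ he

/-- The states of an information system with witnesses form a continuous domain; the states
`[X]_i` are a basis. -/
theorem IsInfoSys.isContinuousDomain (h : 𝒜.IsInfoSys) : IsContinuousDomain 𝒜.State where
  directedComplete _ hne hd := ⟨_, h.isLUB_sUnion hne hd⟩
  hasBasis := by
    refine ⟨Set.univ, fun x => ⟨genSet h x.1, ?_, genSet_nonempty h x, genSet_directed h x,
      genSet_isLUB h x⟩⟩
    rintro _ ⟨i, X, hX, hi, hXx, rfl⟩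
    refine ⟨Set.mem_univ _, fun S hne hd s hs hxs => ?_⟩
    obtain ⟨y, hy, hiy⟩ := h.exists_subset_of_isLUB hne hd hs ((h.finite_of_con hX).insert i)
      ((Set.insert_subset hi hXx).trans hxs)
    exact ⟨y, hy, y.2.gen_subset h (hiy (Set.mem_insert _ _))
      ((Set.subset_insert _ _).trans hiy)⟩

/-! ### Comparison of consistent pairs, closures and applications -/

theorem supp_mono {𝔛 𝔜 : Set (A × Set A)} (hs : 𝔛 ⊆ 𝔜) : supp 𝔛 ⊆ supp 𝔜 :=
  Set.biUnion_subset_biUnion_left hs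

theorem subset_supp {𝔛 : Set (A × Set A)} {p : A × Set A} (hp : p ∈ 𝔛) : p.2 ⊆ supp 𝔛 :=
  Set.subset_biUnion_of_mem (u := fun p : A × Set A => p.2) hp

theorem supp_singleton (p : A × Set A) : supp {p} = p.2 := by
  simp [supp]

theorem supp_empty : supp (∅ : Set (A × Set A)) = ∅ := by
  simp [supp]

/-- `(e, Y)` lies below `(a, S)`: the two witnesses agree on `Y`, and `(a, S)` entails whatever
`(e, Y)` entails. -/
structure IsBelow (𝒜 : InfoFrame A) (e : A) (Y : Set A) (a : A) (S : Set A) : Prop where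
  con : 𝒜.Con a S
  witEq : 𝒜.WitEq Y e a
  gen_subset : 𝒜.gen e Y ⊆ 𝒜.gen a S

theorem IsInfoSys.isBelow_of_subset (h : 𝒜.IsInfoSys) {e a : A} {Y S : Set A} (hS : 𝒜.Con a S)
    (w : 𝒜.WitEq Y e a) (hYS : Y ⊆ S) : 𝒜.IsBelow e Y a S :=
  ⟨hS, w, h.gen_subset_gen w hYS hS⟩

theorem IsInfoSys.isBelow_of_entSet (h : 𝒜.IsInfoSys) {e a : A} {Y S : Set A} (hS : 𝒜.Con a S)
    (w : 𝒜.WitEq Y e a) (hYS : 𝒜.EntSet a S Y) : 𝒜.IsBelow e Y a S :=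
  ⟨hS, w, fun _ hc => h.ent_trans (h.finite_of_con w.con_left) hS hYS (h.ent_of_witEq w hc)⟩

theorem IsInfoSys.isBelow_of_entPair (h : 𝒜.IsInfoSys) {e a : A} {Y S : Set A} (hY : 𝒜.Con e Y)
    (hYS : 𝒜.EntPair a S e Y) : 𝒜.IsBelow e Y a S :=
  h.isBelow_of_entSet (h.con_of_ent hYS.1)
    (h.witEq_of_con_singleton (h.con_singleton_of_ent hYS.1) hY) hYS.2

/-- The witness `j` in the definition of `Cl` can be dropped, since a witness entailed by `(a, S)`
is equivalent to `a`. -/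
theorem IsInfoSys.mem_Cl_iff (h : 𝒜.IsInfoSys) {a : A} {S : Set A} (hS : 𝒜.Con a S)
    {𝔛 : Set (A × Set A)} {p : A × Set A} :
    p ∈ 𝒜.Cl a S 𝔛 ↔ p ∈ 𝔛 ∧ 𝒜.WitEq p.2 a p.1 ∧ 𝒜.EntSet a S p.2 := by
  refine and_congr_right fun _ => ⟨?_, ?_⟩
  · rintro ⟨j, w, hj, hp⟩
    exact ⟨(w.trans (h.witEq_of_con_singleton (h.con_singleton_of_ent hj) w.con_right)).symm, hp⟩
  · rintro ⟨w, hp⟩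
    obtain ⟨e, he, hc⟩ := h.witness_interpolation (h.finite_of_con w.con_left) hS hp
    exact ⟨e, w.symm.trans (h.witEq_of_con_singleton (h.con_singleton_of_ent he) hc).symm, he, hp⟩

theorem IsBelow.Cl_subset {e a : A} {Y S : Set A} (hb : 𝒜.IsBelow e Y a S) (h : 𝒜.IsInfoSys)
    {𝔛 : Set (A × Set A)} : 𝒜.Cl e Y 𝔛 ⊆ 𝒜.Cl a S 𝔛 := by
  intro p hp
  rw [h.mem_Cl_iff hb.witEq.con_left] at hp
  rw [h.mem_Cl_iff hb.con]
  exact ⟨hp.1, (h.witEq_of_entSet (h.finite_of_con hp.2.1.con_left) hb.witEq hp.2.2).symm.trans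
    hp.2.1, fun c hc => hb.gen_subset (hp.2.2 c hc)⟩

theorem IsInfoSys.supp_Cl (h : 𝒜.IsInfoSys) {a : A} {S : Set A} (hS : 𝒜.Con a S)
    {𝔛 : Set (A × Set A)} (h𝔛 : 𝔛.Finite) :
    (supp (𝒜.Cl a S 𝔛)).Finite ∧ 𝒜.EntSet a S (supp (𝒜.Cl a S 𝔛)) := by
  constructor
  · refine (h𝔛.subset fun p hp => hp.1).biUnion fun p hp => ?_
    exact h.finite_of_con ((h.mem_Cl_iff hS).1 hp).2.1.con_left
  · intro c hc
    obtain ⟨p, hp, hcp⟩ := Set.mem_iUnion₂.1 hc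
    exact ((h.mem_Cl_iff hS).1 hp).2.2 c hcp

theorem IsInfoSys.con_supp_Cl (h : 𝒜.IsInfoSys) {a : A} {S : Set A} (hS : 𝒜.Con a S)
    {𝔛 : Set (A × Set A)} (h𝔛 : 𝔛.Finite) : 𝒜.Con a (supp (𝒜.Cl a S 𝔛)) :=
  h.con_of_entSet (h.supp_Cl hS h𝔛).1 hS (h.supp_Cl hS h𝔛).2

theorem ap_subset_ap {a b : A} {S S' : Set A} {𝔙 𝔙' : Set ((A × Set A) × A')} (h𝔙 : 𝔙 ⊆ 𝔙')
    (hCl : 𝒜.Cl a S (Prod.fst '' 𝔙) ⊆ 𝒜.Cl b S' (Prod.fst '' 𝔙)) :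
    𝒜.ap a S 𝔙 ⊆ 𝒜.ap b S' 𝔙' := by
  rintro c ⟨p, hp, hc⟩
  exact ⟨p, ⟨Set.image_mono h𝔙 (hCl hp).1, (hCl hp).2⟩, h𝔙 hc⟩

theorem ap_mono {a : A} {S : Set A} {𝔙 𝔙' : Set ((A × Set A) × A')} (h𝔙 : 𝔙 ⊆ 𝔙') :
    𝒜.ap a S 𝔙 ⊆ 𝒜.ap a S 𝔙' :=
  ap_subset_ap h𝔙 subset_rfl

theorem IsBelow.ap_subset {e a : A} {Y S : Set A} (hb : 𝒜.IsBelow e Y a S) (h : 𝒜.IsInfoSys)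
    {𝔙 : Set ((A × Set A) × A')} : 𝒜.ap e Y 𝔙 ⊆ 𝒜.ap a S 𝔙 :=
  ap_subset_ap subset_rfl (hb.Cl_subset h)

theorem ap_finite {a : A} {S : Set A} {𝔙 : Set ((A × Set A) × A')} (h𝔙 : 𝔙.Finite) :
    (𝒜.ap a S 𝔙).Finite := by
  refine (h𝔙.image Prod.snd).subset ?_
  rintro c ⟨p, -, hc⟩
  exact ⟨_, hc, rfl⟩

theorem rs_finite {a : A} {S : Set A} {𝔙 : Set ((A × Set A) × A')} (h𝔙 : 𝔙.Finite) :
    (𝒜.rs a S 𝔙).Finite :=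
  (h𝔙.subset fun _ hv => hv.1).image _

/-- The elements of `𝔙` whose first component lies in `Cl (a, S)` form the spectrum of `(e, T)`,
where `T` is the union of `Cl (a, S)` and `e ∼ a [T]`. -/
theorem IsInfoSys.spectrum_supp_Cl (h : 𝒜.IsInfoSys) {a e : A} {S : Set A} (hS : 𝒜.Con a S)
    {𝔙 : Set ((A × Set A) × A')} (h𝔙 : 𝔙.Finite)
    (w : 𝒜.WitEq (supp (𝒜.Cl a S (Prod.fst '' 𝔙))) a e) :
    𝒜.spectrum e (supp (𝒜.Cl a S (Prod.fst '' 𝔙))) 𝔙 =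
      {v | v ∈ 𝔙 ∧ v.1 ∈ 𝒜.Cl a S (Prod.fst '' 𝔙)} := by
  ext v
  refine and_congr_right fun hv => ⟨?_, fun hvC => ?_⟩
  · rintro ⟨hw, hsub⟩
    exact (h.mem_Cl_iff hS).2 ⟨Set.mem_image_of_mem _ hv, (h.witEq_mono hsub w).trans hw,
      fun c hc => (h.supp_Cl hS (h𝔙.image _)).2 c (hsub hc)⟩
  · have hsub := subset_supp hvC
    exact ⟨(h.witEq_mono hsub w).symm.trans ((h.mem_Cl_iff hS).1 hvC).2.1, hsub⟩

theorem fst_image_sep_Cl {a : A} {S : Set A} {𝔙 : Set ((A × Set A) × A')} :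
    Prod.fst '' {v | v ∈ 𝔙 ∧ v.1 ∈ 𝒜.Cl a S (Prod.fst '' 𝔙)} = 𝒜.Cl a S (Prod.fst '' 𝔙) := by
  ext p
  constructor
  · rintro ⟨v, hv, rfl⟩
    exact hv.2
  · intro hp
    obtain ⟨v, hv, rfl⟩ := hp.1
    exact ⟨v, ⟨hv, hp⟩, rfl⟩

theorem IsInfoSys.rs_eq_ap (h : 𝒜.IsInfoSys) {a e : A} {S : Set A} (hS : 𝒜.Con a S)
    {𝔙 : Set ((A × Set A) × A')} (h𝔙 : 𝔙.Finite)
    (w : 𝒜.WitEq (supp (𝒜.Cl a S (Prod.fst '' 𝔙))) a e) :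
    𝒜.rs e (supp (𝒜.Cl a S (Prod.fst '' 𝔙))) 𝔙 = 𝒜.ap a S 𝔙 := by
  rw [rs, h.spectrum_supp_Cl hS h𝔙 w]
  ext c
  constructor
  · rintro ⟨⟨p, c⟩, ⟨hv, hp⟩, rfl⟩
    exact ⟨p, hp, hv⟩
  · rintro ⟨p, hp, hc⟩
    exact ⟨(p, c), ⟨hc, hp⟩, rfl⟩

/-- A maximal subset of `𝔙` is determined by its witness and its support. -/
theorem IsMaximalIn.eq_spectrum {𝔙 𝔍 : Set ((A × Set A) × A')} {e : A} (h𝔍 : 𝔍 ⊆ 𝔙)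
    (he : e ∈ 𝒜.commonWit (Prod.fst '' 𝔍)) (hm : 𝒜.IsMaximalIn 𝔙 e 𝔍) :
    𝔍 = 𝒜.spectrum e (supp (Prod.fst '' 𝔍)) 𝔙 := by
  ext v
  constructor
  · intro hv
    have hv' := Set.mem_image_of_mem Prod.fst hv
    exact ⟨h𝔍 hv, he.2 _ hv', subset_supp hv'⟩
  · rintro ⟨hv, hw, hs⟩
    exact hm v hv hs hw

theorem IsInfoSys.mem_commonWit_Cl (h : 𝒜.IsInfoSys) {a : A} {S : Set A} (hS : 𝒜.Con a S)
    {𝔛 : Set (A × Set A)} (h𝔛 : 𝔛.Finite) : a ∈ 𝒜.commonWit (𝒜.Cl a S 𝔛) :=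
  ⟨h.con_supp_Cl hS h𝔛, fun _ hp => ((h.mem_Cl_iff hS).1 hp).2.1⟩

/-- A witness `e ∼ a [⋃ Cl (a, S)]`, together with all elements of `𝔙` whose first component lies in
`Cl (a, S)`, is a maximal pair. -/
theorem IsInfoSys.isMaximalIn_Cl (h : 𝒜.IsInfoSys) {a e : A} {S : Set A} (hS : 𝒜.Con a S)
    {𝔙 : Set ((A × Set A) × A')} (h𝔙 : 𝔙.Finite)
    (w : 𝒜.WitEq (supp (𝒜.Cl a S (Prod.fst '' 𝔙))) a e) :
    𝒜.IsMaximalIn 𝔙 e {v | v ∈ 𝔙 ∧ v.1 ∈ 𝒜.Cl a S (Prod.fst '' 𝔙)} := by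
  intro v hv hsub hw
  rw [fst_image_sep_Cl] at hsub
  rw [← h.spectrum_supp_Cl hS h𝔙 w]
  exact ⟨hv, hw, hsub⟩

/-! ### Values of associates -/

/-- The relevant part of the definition of an associate: the members of the associate belong to
pairs `(e, 𝔍)` with `𝔍` maximal, each such pair has exactly one member, and this member witnesses
the tokens prescribed by the stage below the cardinality of `𝔍`. -/
theorem IsAssociate.exists_stage {𝔙 𝔚 : Set ((A × Set A) × A')} (h𝔙 : 𝔙.Finite)
    (hW : IsAssociate 𝒜 𝒜' 𝔙 𝔚) :
    ∃ (R : Set (A × Set A) → Set A) (stage : ℕ → Set ((A × Set A) × A')),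
      𝒜.IsRepChoice 𝔙 R ∧ Monotone stage ∧
      (∀ e T j, ((e, T), j) ∈ 𝔚 → ∃ 𝔍 ⊆ 𝔙, e ∈ R (Prod.fst '' 𝔍) ∧ 𝒜.IsMaximalIn 𝔙 e 𝔍 ∧
        T = supp (Prod.fst '' 𝔍) ∧ ((e, T), j) ∈ stage 𝔍.ncard ∧
        ∀ κ, 𝔍.ncard = κ + 1 → 𝒜'.Con j (𝒜.toWitness 𝔙 R (stage κ) e 𝔍)) ∧
      (∀ 𝔍 ⊆ 𝔙, ∀ e ∈ R (Prod.fst '' 𝔍), 𝒜.IsMaximalIn 𝔙 e 𝔍 →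
        ∃! j, ((e, supp (Prod.fst '' 𝔍)), j) ∈ 𝔚) := by
  obtain ⟨R, hR, stage, new, rfl, h0, hs⟩ := hW
  have key : ∀ e T j, ((e, T), j) ∈ ⋃ κ, stage κ →
      ∃ 𝔍 ⊆ 𝔙, e ∈ R (Prod.fst '' 𝔍) ∧ 𝒜.IsMaximalIn 𝔙 e 𝔍 ∧ T = supp (Prod.fst '' 𝔍) ∧
        (𝔍 = ∅ ∧ j = 𝒜'.truth ∧ ((e, T), j) ∈ stage 0 ∨ ∃ κ, 𝔍.ncard = κ + 1 ∧
          𝒜'.Con j (𝒜.toWitness 𝔙 R (stage κ) e 𝔍) ∧ ((e, T), j) ∈ new (κ + 1)) := by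
    intro e T j hj
    obtain ⟨κ, hκ⟩ := Set.mem_iUnion.1 hj
    induction κ with
    | zero =>
      have hκ' := hκ
      rw [h0] at hκ
      obtain ⟨heq, hm⟩ := hκ
      simp only [Prod.mk.injEq] at heq
      obtain ⟨⟨rfl, rfl⟩, rfl⟩ := heq
      refine ⟨∅, Set.empty_subset _, ?_, hm, ?_, Or.inl ⟨rfl, rfl, hκ'⟩⟩
      · rw [Set.image_empty, hR.empty]
        rfl
      · rw [Set.image_empty, supp_empty]
    | succ κ ih =>
      rw [(hs κ).1] at hκ
      rcases hκ with hκ | hκ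
      · exact ih hκ
      · obtain ⟨𝔍, h𝔍, he, hc, hm, hT, hcon⟩ := (hs κ).2.2 e T j hκ
        exact ⟨𝔍, h𝔍, he, hm, hT, Or.inr ⟨κ, hc, hcon, hκ⟩⟩
  refine ⟨R, stage, hR, monotone_nat_of_le_succ fun κ => ?_, ?_, ?_⟩
  · rw [(hs κ).1]
    exact Set.subset_union_left
  · intro e T j hj
    obtain ⟨𝔍, h𝔍, he, hm, hT, ⟨rfl, rfl, hst⟩ | ⟨κ, hc, hcon, hnew⟩⟩ := key e T j hj
    · refine ⟨∅, h𝔍, he, hm, hT, ?_, fun κ hκ => ?_⟩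
      · rwa [Set.ncard_empty]
      · rw [Set.ncard_empty] at hκ
        omega
    · refine ⟨𝔍, h𝔍, he, hm, hT, ?_, fun κ' hκ' => ?_⟩
      · rw [hc, (hs κ).1]
        exact Or.inr hnew
      · obtain rfl : κ = κ' := by omega
        exact hcon
  · intro 𝔍 h𝔍 e he hm
    have huniq : ∀ j, ((e, supp (Prod.fst '' 𝔍)), j) ∈ ⋃ κ, stage κ →
        (𝔍 = ∅ ∧ j = 𝒜'.truth ∨ ∃ κ, 𝔍.ncard = κ + 1 ∧
          𝒜'.Con j (𝒜.toWitness 𝔙 R (stage κ) e 𝔍) ∧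
          ((e, supp (Prod.fst '' 𝔍)), j) ∈ new (κ + 1)) := by
      intro j hj
      obtain ⟨𝔎, h𝔎, he', hm', hT, hcase⟩ := key _ _ _ hj
      obtain rfl : 𝔍 = 𝔎 := by
        rw [hm.eq_spectrum h𝔍 (hR.subset 𝔍 h𝔍 he), hm'.eq_spectrum h𝔎 (hR.subset 𝔎 h𝔎 he'), hT]
      exact hcase.imp (fun hst => ⟨hst.1, hst.2.1⟩) id
    rcases Nat.eq_zero_or_eq_succ_pred 𝔍.ncard with hc | hc
    · obtain rfl := (Set.ncard_eq_zero (h𝔙.subset h𝔍)).1 hc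
      have he' := he
      rw [Set.image_empty, hR.empty] at he'
      obtain rfl : e = 𝒜.truth := he'
      refine ⟨𝒜'.truth, Set.mem_iUnion.2 ⟨0, ?_⟩, fun j hj => ?_⟩
      · rw [h0, Set.image_empty, supp_empty]
        exact ⟨rfl, hm⟩
      · rcases huniq j hj with ⟨-, rfl⟩ | ⟨κ, hκ, -⟩
        · rfl
        · omega
    · set κ := 𝔍.ncard.pred
      obtain ⟨j, ⟨-, hj⟩, hj'⟩ := (hs κ).2.1 𝔍 h𝔍 hc e he hm
      refine ⟨j, Set.mem_iUnion.2 ⟨κ + 1, ?_⟩, fun i hi => ?_⟩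
      · rw [(hs κ).1]
        exact Or.inr hj
      · rcases huniq i hi with ⟨rfl, -⟩ | ⟨κ', hκ', hi'⟩
        · rw [Set.ncard_empty] at hc
          omega
        · obtain rfl : κ = κ' := by omega
          exact hj' i hi'

namespace FunToken

variable {τ : FunToken 𝒜 𝒜'}

/-- A member `((e, T), j)` of an associate has `(e, T)` consistent, and `j` witnesses the right
hand sides in the spectrum of `(e, T)`. -/
theorem con_of_mem_assoc (h' : 𝒜'.IsInfoSys) {e : A} {T : Set A} {j : A'}
    (hj : ((e, T), j) ∈ τ.assoc) : 𝒜.Con e T ∧ 𝒜'.Con j (𝒜.rs e T τ.base) := by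
  obtain ⟨R, stage, hR, -, hmem, -⟩ := τ.isAssociate.exists_stage τ.base_finite
  obtain ⟨𝔍, h𝔍, he, hm, rfl, -, hcon⟩ := hmem e T j hj
  have hew := hR.subset 𝔍 h𝔍 he
  refine ⟨hew.1, ?_⟩
  rw [rs, ← hm.eq_spectrum h𝔍 hew]
  rcases Nat.eq_zero_or_eq_succ_pred 𝔍.ncard with hc | hc
  · obtain rfl := (Set.ncard_eq_zero (τ.base_finite.subset h𝔍)).1 hc
    rw [Set.image_empty]
    exact h'.con_empty j
  · refine h'.con_mono ?_ (hcon _ hc)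
    rintro _ ⟨⟨⟨i, X⟩, c⟩, hv, rfl⟩
    have hv' := Set.mem_image_of_mem Prod.fst hv
    refine ⟨i, {((i, X), c)}, Set.singleton_subset_iff.2 (h𝔍 hv), ?_, ?_, Or.inl ⟨?_, ?_⟩⟩
    · rw [Set.image_singleton, supp_singleton]
      exact subset_supp hv'
    · rw [Set.image_singleton, supp_singleton]
      exact (hew.2 _ hv').symm
    · exact Set.ncard_singleton _
    · rw [Set.image_singleton, supp_singleton]
      exact h𝔍 hv

theorem exists_isValue (h : 𝒜.IsInfoSys) (h' : 𝒜'.IsInfoSys) {a : A} {S : Set A}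
    (hS : 𝒜.Con a S) : ∃ j e T, τ.IsValue a S e T j := by
  obtain ⟨R, stage, hR, -, -, hex⟩ := τ.isAssociate.exists_stage τ.base_finite
  set 𝔍 := {v | v ∈ τ.base ∧ v.1 ∈ 𝒜.Cl a S (Prod.fst '' τ.base)} with h𝔍def
  have h𝔍 : 𝔍 ⊆ τ.base := fun v hv => hv.1
  have hfst : Prod.fst '' 𝔍 = 𝒜.Cl a S (Prod.fst '' τ.base) := fst_image_sep_Cl
  have ha := h.mem_commonWit_Cl hS (τ.base_finite.image Prod.fst)
  obtain ⟨e, ⟨he, w⟩, -⟩ := hR.existsUnique 𝔍 h𝔍 a (hfst ▸ ha)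
  have hm : 𝒜.IsMaximalIn τ.base e 𝔍 := h.isMaximalIn_Cl hS τ.base_finite (hfst ▸ w)
  obtain ⟨j, hj, -⟩ := hex 𝔍 h𝔍 e he hm
  refine ⟨j, e, _, rfl, hfst ▸ hR.subset 𝔍 h𝔍 he, hfst ▸ w, ?_, hfst ▸ hj⟩
  rw [← h.rs_eq_ap hS τ.base_finite (hfst ▸ w)]
  exact (con_of_mem_assoc h' (hfst ▸ hj)).2

theorem exists_isValue_wit (h : 𝒜.IsInfoSys) (h' : 𝒜'.IsInfoSys) (τ : FunToken 𝒜 𝒜') {a : A}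
    {S : Set A} (hS : 𝒜.Con a S) : ∃ e T, τ.IsValue a S e T (τ.wit a S) := by
  have hex := τ.exists_isValue h h' hS
  rw [wit, dif_pos hex]
  exact hex.choose_spec

theorem con_wit_ap (h : 𝒜.IsInfoSys) (h' : 𝒜'.IsInfoSys) (τ : FunToken 𝒜 𝒜') {a : A}
    {S : Set A} (hS : 𝒜.Con a S) : 𝒜'.Con (τ.wit a S) (𝒜.ap a S τ.base) := by
  obtain ⟨e, T, hv⟩ := τ.exists_isValue_wit h h' hS
  exact hv.2.2.2.1

/-- `𝔚₂(a, S)` occurs in the associate at a pair below `(a, S)` with the same spectrum. -/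
theorem exists_mem_assoc (h : 𝒜.IsInfoSys) (h' : 𝒜'.IsInfoSys) (τ : FunToken 𝒜 𝒜') {a : A}
    {S : Set A} (hS : 𝒜.Con a S) : ∃ e T, ((e, T), τ.wit a S) ∈ τ.assoc ∧
      𝒜.IsBelow e T a S ∧ 𝒜.rs e T τ.base = 𝒜.ap a S τ.base := by
  obtain ⟨e, T, rfl, -, w, -, hj⟩ := τ.exists_isValue_wit h h' hS
  exact ⟨e, _, hj, h.isBelow_of_entSet hS w.symm (h.supp_Cl hS (τ.base_finite.image _)).2,
    h.rs_eq_ap hS τ.base_finite w⟩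

/-- Values of a token grow with the closure: if `Cl (a, S) ⊆ Cl (b, S')`, then either both
values are the same member of the associate, or the value at `(a, S)` is among the tokens that the
value at `(b, S')` has to witness. -/
theorem con_wit_singleton (h : 𝒜.IsInfoSys) (h' : 𝒜'.IsInfoSys) (τ : FunToken 𝒜 𝒜') {a b : A}
    {S S' : Set A} (hS : 𝒜.Con a S) (hS' : 𝒜.Con b S')
    (hCl : 𝒜.Cl a S (Prod.fst '' τ.base) ⊆ 𝒜.Cl b S' (Prod.fst '' τ.base))
    (w : 𝒜.WitEq (supp (𝒜.Cl a S (Prod.fst '' τ.base))) a b) :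
    𝒜'.Con (τ.wit b S') {τ.wit a S} := by
  obtain ⟨e, T, rfl, -, wa, -, hj⟩ := τ.exists_isValue_wit h h' hS
  obtain ⟨e', T', rfl, -, wb, -, hj'⟩ := τ.exists_isValue_wit h h' hS'
  obtain ⟨R, stage, hR, hmono, hmem, hex⟩ := τ.isAssociate.exists_stage τ.base_finite
  obtain ⟨𝔎, h𝔎, he, hm, hT, hst, -⟩ := hmem _ _ _ hj
  obtain ⟨𝔍, h𝔍, he', hm', hT', -, hcon⟩ := hmem _ _ _ hj'
  have e𝔎 := hm.eq_spectrum h𝔎 (hR.subset 𝔎 h𝔎 he)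
  have e𝔍 := hm'.eq_spectrum h𝔍 (hR.subset 𝔍 h𝔍 he')
  rw [← hT, h.spectrum_supp_Cl hS τ.base_finite wa] at e𝔎
  rw [← hT', h.spectrum_supp_Cl hS' τ.base_finite wb] at e𝔍
  have hsub : 𝔎 ⊆ 𝔍 := by
    rw [e𝔎, e𝔍]
    exact fun v hv => ⟨hv.1, hCl hv.2⟩
  have wee : 𝒜.WitEq (supp (𝒜.Cl a S (Prod.fst '' τ.base))) e e' :=
    (wa.symm.trans w).trans (h.witEq_mono (supp_mono hCl) wb)
  have h𝔍fin := τ.base_finite.subset h𝔍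
  by_cases heq : 𝔎 = 𝔍
  · subst heq
    have hee : e = e' := by
      refine (hR.existsUnique 𝔎 h𝔎 e (hR.subset 𝔎 h𝔎 he)).unique ⟨he, ?_⟩ ⟨he', ?_⟩
      · exact hT ▸ h.witEq_refl wa.con_right
      · exact hT ▸ wee
    subst hee
    rw [hT] at hj
    rw [hT'] at hj'
    rw [(hex 𝔎 h𝔎 e he hm).unique hj hj']
    exact h'.con_self _
  · have hlt : 𝔎.ncard < 𝔍.ncard := Set.ncard_lt_ncard (hsub.ssubset_of_ne heq) h𝔍fin
    obtain ⟨κ, hκ⟩ : ∃ κ, 𝔍.ncard = κ + 1 := ⟨𝔍.ncard - 1, by omega⟩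
    refine h'.con_mono (Set.singleton_subset_iff.2 ?_) (hcon κ hκ)
    refine ⟨e, 𝔎, h𝔎, supp_mono (Set.image_mono hsub), hT ▸ wee, Or.inr ⟨he, ?_⟩⟩
    rw [← hT]
    exact hmono (by omega : 𝔎.ncard ≤ κ) hst

theorem con_wit_of_isBelow (h : 𝒜.IsInfoSys) (h' : 𝒜'.IsInfoSys) (τ : FunToken 𝒜 𝒜') {e a : A}
    {Y S : Set A} (hb : 𝒜.IsBelow e Y a S) : 𝒜'.Con (τ.wit a S) {τ.wit e Y} := by
  obtain ⟨hfin, hent⟩ := h.supp_Cl hb.witEq.con_left (τ.base_finite.image Prod.fst)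
  exact τ.con_wit_singleton h h' hb.witEq.con_left hb.con (hb.Cl_subset h)
    (h.witEq_of_entSet hfin hb.witEq hent)

end FunToken

/-! ### Approximable relations -/

/-- An approximable relation between `Con` and `A'`: it grows along `IsBelow`, its fibres are
states, and each of its members already holds at a consistent pair entailed by the given one. These
are the relations that correspond to Scott continuous functions between the domains of states. -/
structure IsApproximable (𝒜 : InfoFrame A) (𝒜' : InfoFrame A') (H : Set ((A × Set A) × A')) :
    Prop where
  con : ∀ {a S t}, ((a, S), t) ∈ H → 𝒜.Con a S
  mono : ∀ {e Y a S t}, 𝒜.IsBelow e Y a S → ((e, Y), t) ∈ H → ((a, S), t) ∈ H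
  isState : ∀ {a S}, 𝒜.Con a S → 𝒜'.IsState {t | ((a, S), t) ∈ H}
  interpolation : ∀ {a S t}, ((a, S), t) ∈ H →
    ∃ e Y, 𝒜.EntPair a S e Y ∧ 𝒜.Con e Y ∧ ((e, Y), t) ∈ H

/-! ### Existence of associates -/

open Classical in
/-- The representative of the class of `a` modulo `∼ [⋃ pr₂ 𝔛]`; for at most one pair in `𝔛` it is
the prescribed one. -/
noncomputable def rep (𝒜 : InfoFrame A) (𝔛 : Set (A × Set A)) (a : A) : A :=
  if 𝔛 = ∅ then 𝒜.truth
  else if hp : ∃ p, 𝔛 = {p} then hp.choose.1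
  else @Classical.epsilon A ⟨a⟩ (𝒜.WitEq (supp 𝔛) a)

theorem IsInfoSys.witEq_rep (h : 𝒜.IsInfoSys) {𝔛 : Set (A × Set A)} {a : A}
    (ha : a ∈ 𝒜.commonWit 𝔛) : 𝒜.WitEq (supp 𝔛) a (𝒜.rep 𝔛 a) := by
  rw [rep]
  split_ifs with h0 hp
  · rw [h0, supp_empty]
    exact h.witEq_truth a
  · have hsp := hp.choose_spec
    have hmem : hp.choose ∈ 𝔛 := hsp.symm.subset (Set.mem_singleton _)
    have hs : supp 𝔛 = hp.choose.2 := (congrArg supp hsp).trans (supp_singleton _)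
    rw [hs]
    exact ha.2 _ hmem
  · exact Classical.epsilon_spec (p := 𝒜.WitEq (supp 𝔛) a) ⟨a, h.witEq_refl ha.1⟩

theorem rep_congr {𝔛 : Set (A × Set A)} {a b : A} (w : 𝒜.WitEq (supp 𝔛) a b) :
    𝒜.rep 𝔛 a = 𝒜.rep 𝔛 b := by
  have : 𝒜.WitEq (supp 𝔛) a = 𝒜.WitEq (supp 𝔛) b :=
    funext fun c => propext ⟨w.symm.trans, w.trans⟩
  rw [rep, rep, this]

theorem IsInfoSys.mem_commonWit_of_witEq (h : 𝒜.IsInfoSys) {𝔛 : Set (A × Set A)} {a b : A}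
    (ha : a ∈ 𝒜.commonWit 𝔛) (w : 𝒜.WitEq (supp 𝔛) a b) : b ∈ 𝒜.commonWit 𝔛 :=
  ⟨w.con_right, fun p hp => (h.witEq_mono (subset_supp hp) w).symm.trans (ha.2 p hp)⟩

theorem IsInfoSys.isRepChoice (h : 𝒜.IsInfoSys) {𝔙 : Set ((A × Set A) × A')}
    (hc : ∀ v ∈ 𝔙, 𝒜.Con v.1.1 v.1.2) :
    𝒜.IsRepChoice 𝔙 (fun 𝔛 => 𝒜.rep 𝔛 '' 𝒜.commonWit 𝔛) where
  subset 𝔍 _ := by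
    rintro _ ⟨a, ha, rfl⟩
    exact h.mem_commonWit_of_witEq ha (h.witEq_rep ha)
  existsUnique 𝔍 _ a ha := by
    refine ⟨_, ⟨⟨a, ha, rfl⟩, h.witEq_rep ha⟩, ?_⟩
    rintro _ ⟨⟨b, hb, rfl⟩, w⟩
    exact (rep_congr (w.trans (h.witEq_rep hb).symm)).symm
  empty := by
    have hne : (𝒜.commonWit ∅).Nonempty :=
      ⟨𝒜.truth, by rw [supp_empty]; exact h.con_empty _, fun p hp => hp.elim⟩
    have : ∀ a, 𝒜.rep ∅ a = 𝒜.truth := fun a => if_pos rfl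
    simp only [this]
    exact hne.image_const _
  singleton v hv := by
    have hmem : v.1.1 ∈ 𝒜.commonWit {v.1} := by
      refine ⟨by rw [supp_singleton]; exact hc v hv, ?_⟩
      rintro p rfl
      exact h.witEq_refl (hc v hv)
    have : ∀ a, 𝒜.rep {v.1} a = v.1.1 := by
      intro a
      have hp : ∃ p, ({v.1} : Set (A × Set A)) = {p} := ⟨_, rfl⟩
      rw [rep, if_neg (Set.singleton_ne_empty _), dif_pos hp,
        ← Set.singleton_injective hp.choose_spec]
    simp only [this]
    exact Set.Nonempty.image_const ⟨_, hmem⟩ _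

/-- The member of the associate chosen for `(e, T)`: a token related to `(e, T)` that witnesses the
finitely many tokens in `Q`. -/
noncomputable def nextWit (𝒜' : InfoFrame A') (H : Set ((A × Set A) × A')) (e : A) (T : Set A)
    (Q : Set A') : A' :=
  @Classical.epsilon A' ⟨𝒜'.truth⟩ fun j => ((e, T), j) ∈ H ∧ 𝒜'.Con j Q

/-- The part added to the stage `𝔓` of an associate by the subsets of `𝔙` with `n` elements. -/
def newPart (𝒜 : InfoFrame A) (𝒜' : InfoFrame A') (H 𝔙 : Set ((A × Set A) × A'))
    (R : Set (A × Set A) → Set A) (𝔓 : Set ((A × Set A) × A')) (n : ℕ) :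
    Set ((A × Set A) × A') :=
  {m | ∃ 𝔍 ⊆ 𝔙, m.1.1 ∈ R (Prod.fst '' 𝔍) ∧ 𝔍.ncard = n ∧ 𝒜.IsMaximalIn 𝔙 m.1.1 𝔍 ∧
    m.1.2 = supp (Prod.fst '' 𝔍) ∧
    m.2 = nextWit 𝒜' H m.1.1 m.1.2 (𝒜.toWitness 𝔙 R 𝔓 m.1.1 𝔍)}

/-- The stages of an associate of `𝔙` with members in `H`. -/
def assocStage (𝒜 : InfoFrame A) (𝒜' : InfoFrame A') (H 𝔙 : Set ((A × Set A) × A'))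
    (R : Set (A × Set A) → Set A) : ℕ → Set ((A × Set A) × A')
  | 0 => {m | m = ((𝒜.truth, ∅), 𝒜'.truth) ∧ 𝒜.IsMaximalIn 𝔙 𝒜.truth ∅}
  | n + 1 => assocStage 𝒜 𝒜' H 𝔙 R n ∪
      newPart 𝒜 𝒜' H 𝔙 R (assocStage 𝒜 𝒜' H 𝔙 R n) (n + 1)

section

variable {H 𝔙 : Set ((A × Set A) × A')} {R : Set (A × Set A) → Set A}

theorem assocStage_fibre_finite (h𝔙 : 𝔙.Finite) (n : ℕ) (p : A × Set A) :
    {t | (p, t) ∈ assocStage 𝒜 𝒜' H 𝔙 R n}.Finite := by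
  induction n with
  | zero =>
    refine (Set.finite_singleton 𝒜'.truth).subset ?_
    rintro t ⟨ht, -⟩
    exact congrArg Prod.snd ht
  | succ n ih =>
    refine (ih.union ((h𝔙.finite_subsets.image fun 𝔍 => nextWit 𝒜' H p.1 p.2
      (𝒜.toWitness 𝔙 R (assocStage 𝒜 𝒜' H 𝔙 R n) p.1 𝔍)))).subset ?_
    rintro t (ht | ⟨𝔍, h𝔍, -, -, -, -, ht⟩)
    · exact Or.inl ht
    · exact Or.inr ⟨𝔍, h𝔍, ht.symm⟩

/-- Only finitely many tokens have to be witnessed: among the representatives of a given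
subset of `𝔙` at most one is equivalent to `e`. -/
theorem toWitness_finite (h : 𝒜.IsInfoSys) (h𝔙 : 𝔙.Finite) (hR : 𝒜.IsRepChoice 𝔙 R)
    {𝔓 : Set ((A × Set A) × A')} (h𝔓 : ∀ p, {t | (p, t) ∈ 𝔓}.Finite) (e : A)
    (𝔍 : Set ((A × Set A) × A')) : (𝒜.toWitness 𝔙 R 𝔓 e 𝔍).Finite := by
  have hsub : 𝒜.toWitness 𝔙 R 𝔓 e 𝔍 ⊆ Prod.snd '' 𝔙 ∪ ⋃ 𝔎 ∈ {𝔎 | 𝔎 ⊆ 𝔙},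
      ⋃ a ∈ {a | a ∈ R (Prod.fst '' 𝔎) ∧ 𝒜.WitEq (supp (Prod.fst '' 𝔎)) a e},
        {t | ((a, supp (Prod.fst '' 𝔎)), t) ∈ 𝔓} := by
    rintro t ⟨a, 𝔎, h𝔎, -, w, ⟨-, ht⟩ | ⟨ha, ht⟩⟩
    · exact Or.inl ⟨_, ht, rfl⟩
    · exact Or.inr (Set.mem_biUnion (show 𝔎 ∈ {𝔎 | 𝔎 ⊆ 𝔙} from h𝔎)
        (Set.mem_biUnion (show a ∈ {a | _ ∧ _} from ⟨ha, w⟩) ht))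
  refine ((h𝔙.image _).union (h𝔙.finite_subsets.biUnion fun 𝔎 h𝔎 =>
    (Set.Subsingleton.finite ?_).biUnion fun a _ => h𝔓 _)).subset hsub
  rintro a ⟨ha, wa⟩ b ⟨hb, wb⟩
  have hac := hR.subset 𝔎 h𝔎 ha
  exact (hR.existsUnique 𝔎 h𝔎 a hac).unique ⟨ha, h.witEq_refl wa.con_left⟩
    ⟨hb, wa.trans wb.symm⟩

end

/-- The tokens to be witnessed form a finite subset of one fibre of `H`, so that a witness for them
exists in this fibre. -/
theorem IsApproximable.nextWit_spec {H 𝔙 𝔓 : Set ((A × Set A) × A')}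
    {R : Set (A × Set A) → Set A} (hH : IsApproximable 𝒜 𝒜' H) (h : 𝒜.IsInfoSys)
    (h𝔙 : 𝔙.Finite) (hVH : 𝔙 ⊆ H) (hR : 𝒜.IsRepChoice 𝔙 R) (h𝔓 : ∀ p, {t | (p, t) ∈ 𝔓}.Finite)
    (hPH : 𝔓 ⊆ H) {𝔍 : Set ((A × Set A) × A')} (h𝔍 : 𝔍 ⊆ 𝔙) {e : A}
    (he : e ∈ R (Prod.fst '' 𝔍)) :
    ((e, supp (Prod.fst '' 𝔍)), nextWit 𝒜' H e (supp (Prod.fst '' 𝔍))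
      (𝒜.toWitness 𝔙 R 𝔓 e 𝔍)) ∈ H ∧
    𝒜'.Con (nextWit 𝒜' H e (supp (Prod.fst '' 𝔍)) (𝒜.toWitness 𝔙 R 𝔓 e 𝔍))
      (𝒜.toWitness 𝔙 R 𝔓 e 𝔍) := by
  have hcon := (hR.subset 𝔍 h𝔍 he).1
  have hsub : 𝒜.toWitness 𝔙 R 𝔓 e 𝔍 ⊆ {t | ((e, supp (Prod.fst '' 𝔍)), t) ∈ H} := by
    rintro t ⟨a, 𝔎, -, hs, w, ht⟩
    refine hH.mono (h.isBelow_of_subset hcon w hs) ?_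
    exact ht.elim (fun ht => hVH ht.2) (fun ht => hPH ht.2)
  obtain ⟨j, hj, hjc⟩ := (hH.isState hcon).consistent _ hsub (toWitness_finite h h𝔙 hR h𝔓 e 𝔍)
  exact Classical.epsilon_spec
    (p := fun j => ((e, supp (Prod.fst '' 𝔍)), j) ∈ H ∧ 𝒜'.Con j (𝒜.toWitness 𝔙 R 𝔓 e 𝔍))
    ⟨j, hj, hjc⟩

theorem IsApproximable.assocStage_subset {H 𝔙 : Set ((A × Set A) × A')}
    {R : Set (A × Set A) → Set A} (hH : IsApproximable 𝒜 𝒜' H) (h : 𝒜.IsInfoSys)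
    (h' : 𝒜'.IsInfoSys) (h𝔙 : 𝔙.Finite) (hVH : 𝔙 ⊆ H) (hR : 𝒜.IsRepChoice 𝔙 R) (n : ℕ) :
    assocStage 𝒜 𝒜' H 𝔙 R n ⊆ H := by
  induction n with
  | zero =>
    rintro _ ⟨rfl, -⟩
    exact (hH.isState (h.con_empty _)).truth_mem h'
  | succ n ih =>
    rintro ⟨⟨e, T⟩, j⟩ (hm | ⟨𝔍, h𝔍, he, -, -, hT, hj⟩)
    · exact ih hm
    · obtain rfl : T = supp (Prod.fst '' 𝔍) := hT
      dsimp only at hj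
      subst hj
      exact (hH.nextWit_spec h h𝔙 hVH hR (assocStage_fibre_finite h𝔙 n) ih h𝔍 he).1

/-- A finite subset `𝔙` of an approximable relation has an associate inside the relation: the
witnesses required by the construction exist because the fibres of the relation are states. -/
theorem IsApproximable.exists_token {H 𝔙 : Set ((A × Set A) × A')}
    (hH : IsApproximable 𝒜 𝒜' H) (h : 𝒜.IsInfoSys) (h' : 𝒜'.IsInfoSys) (h𝔙 : 𝔙.Finite)
    (hVH : 𝔙 ⊆ H) : ∃ ε : FunToken 𝒜 𝒜', ε.base = 𝔙 ∧ ε.assoc ⊆ H := by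
  have hc : ∀ v ∈ 𝔙, 𝒜.Con v.1.1 v.1.2 := fun v hv => hH.con (hVH hv)
  have hR := h.isRepChoice hc
  set R := fun 𝔛 => 𝒜.rep 𝔛 '' 𝒜.commonWit 𝔛
  have hstage := hH.assocStage_subset h h' h𝔙 hVH hR
  -- The part added at `0` is not used by the definition, so the truncated `n - 1` is harmless.
  refine ⟨⟨⋃ n, assocStage 𝒜 𝒜' H 𝔙 R n, 𝔙, h𝔙, hc, R, hR, assocStage 𝒜 𝒜' H 𝔙 R,
    fun n => newPart 𝒜 𝒜' H 𝔙 R (assocStage 𝒜 𝒜' H 𝔙 R (n - 1)) n, rfl, rfl,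
    fun n => ⟨rfl, ?_, ?_⟩⟩,
    rfl, Set.iUnion_subset hstage⟩
  · intro 𝔍 h𝔍 hn e he hm
    obtain ⟨-, hcon⟩ := hH.nextWit_spec h h𝔙 hVH hR (assocStage_fibre_finite h𝔙 n) (hstage n)
      h𝔍 he
    refine ⟨_, ⟨hcon, 𝔍, h𝔍, he, hn, hm, rfl, rfl⟩, ?_⟩
    rintro j ⟨-, 𝔎, h𝔎, he', -, hm', hT, hj⟩
    obtain rfl : 𝔍 = 𝔎 := by
      rw [hm.eq_spectrum h𝔍 (hR.subset 𝔍 h𝔍 he), hm'.eq_spectrum h𝔎 (hR.subset 𝔎 h𝔎 he')]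
      exact congrArg (𝒜.spectrum e · 𝔙) hT
    exact hj
  · rintro a T b ⟨𝔍, h𝔍, he, hn, hm, hT, hb⟩
    obtain rfl : T = supp (Prod.fst '' 𝔍) := hT
    dsimp only at hb
    subst hb
    exact ⟨𝔍, h𝔍, he, hn, hm, rfl,
      (hH.nextWit_spec h h𝔙 hVH hR (assocStage_fibre_finite h𝔙 n) (hstage n) h𝔍 he).2⟩

/-! ### Consistency and entailment in the function space -/

theorem subset_baseUnion {𝒯 : Set (FunToken 𝒜 𝒜')} {σ : FunToken 𝒜 𝒜'} (hσ : σ ∈ 𝒯) :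
    σ.base ⊆ baseUnion 𝒯 :=
  Set.subset_biUnion_of_mem (u := fun σ : FunToken 𝒜 𝒜' => σ.base) hσ

theorem baseUnion_mono {𝒯 𝒯' : Set (FunToken 𝒜 𝒜')} (hs : 𝒯 ⊆ 𝒯') :
    baseUnion 𝒯 ⊆ baseUnion 𝒯' :=
  Set.biUnion_subset_biUnion_left hs

theorem baseUnion_singleton (σ : FunToken 𝒜 𝒜') : baseUnion {σ} = σ.base := by
  simp [baseUnion]

theorem baseUnion_finite {𝒯 : Set (FunToken 𝒜 𝒜')} (h𝒯 : 𝒯.Finite) : (baseUnion 𝒯).Finite :=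
  h𝒯.biUnion fun σ _ => σ.base_finite

/-- The witness `k` in the definition of consistency can be replaced by the value of `τ`. -/
theorem funCon_iff (h' : 𝒜'.IsInfoSys) {τ : FunToken 𝒜 𝒜'} {𝒯 : Set (FunToken 𝒜 𝒜')} :
    FunCon 𝒜 𝒜' τ 𝒯 ↔ 𝒯.Finite ∧ ∀ a S, 𝒜.Con a S →
      (∀ σ ∈ 𝒯, 𝒜'.WitEq (𝒜.ap a S σ.base) (σ.wit a S) (τ.wit a S)) ∧
      (∀ r, 𝒜'.WitEq (𝒜.ap a S τ.base) r (τ.wit a S) →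
        𝒜'.WitEq (𝒜.ap a S (baseUnion 𝒯)) r (τ.wit a S)) := by
  refine and_congr_right fun _ => forall₂_congr fun a S => imp_congr_right fun _ =>
    and_congr_left fun _ => forall₂_congr fun σ _ => ⟨?_, fun w => ⟨_, w, h'.con_self _⟩⟩
  rintro ⟨k, w, hk⟩
  exact w.trans (h'.witEq_of_con_singleton hk w.con_right)

theorem FunCon.con_ap {τ : FunToken 𝒜 𝒜'} {𝒯 : Set (FunToken 𝒜 𝒜')}
    (hc : FunCon 𝒜 𝒜' τ 𝒯) (h : 𝒜.IsInfoSys) (h' : 𝒜'.IsInfoSys) {a : A} {S : Set A}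
    (hS : 𝒜.Con a S) : 𝒜'.Con (τ.wit a S) (𝒜.ap a S (baseUnion 𝒯)) :=
  ((hc.2 a S hS).2 _ (h'.witEq_refl (τ.con_wit_ap h h' hS))).con_left

theorem funCon_self (h : 𝒜.IsInfoSys) (h' : 𝒜'.IsInfoSys) (τ : FunToken 𝒜 𝒜') :
    FunCon 𝒜 𝒜' τ {τ} := by
  refine (funCon_iff h').2 ⟨Set.finite_singleton _, fun a S hS => ⟨?_, fun r w => ?_⟩⟩
  · rintro σ rfl
    exact h'.witEq_refl (σ.con_wit_ap h h' hS)
  · rwa [baseUnion_singleton]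

/-- The relation between `Con` and `A'` described by a pair `(τ, 𝒯)` of the function space: the
value of `τ` at `(a, S)`, together with the tokens that `𝒯` assigns to `(a, S)`, entails `t`. -/
def graphOf (τ : FunToken 𝒜 𝒜') (𝒯 : Set (FunToken 𝒜 𝒜')) : Set ((A × Set A) × A') :=
  {p | 𝒜.Con p.1.1 p.1.2 ∧
    𝒜'.Ent (τ.wit p.1.1 p.1.2) (𝒜.ap p.1.1 p.1.2 (baseUnion 𝒯)) p.2}

theorem FunCon.isApproximable {τ : FunToken 𝒜 𝒜'} {𝒯 : Set (FunToken 𝒜 𝒜')}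
    (hc : FunCon 𝒜 𝒜' τ 𝒯) (h : 𝒜.IsInfoSys) (h' : 𝒜'.IsInfoSys) :
    IsApproximable 𝒜 𝒜' (graphOf τ 𝒯) where
  con hp := hp.1
  mono {e Y a S t} hb hp :=
    ⟨hb.con, h'.gen_subset_gen (h'.witEq_of_con_singleton (τ.con_wit_of_isBelow h h' hb)
      (hc.con_ap h h' hb.witEq.con_left)) (hb.ap_subset h) (hc.con_ap h h' hb.con) hp.2⟩
  isState {a S} hS := by
    have : {t | ((a, S), t) ∈ graphOf τ 𝒯} =
        𝒜'.gen (τ.wit a S) (𝒜.ap a S (baseUnion 𝒯)) :=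
      Set.ext fun t => and_iff_right hS
    rw [this]
    exact h'.isState_gen (hc.con_ap h h' hS)
  interpolation {a S t} hp := by
    obtain ⟨hS, ht⟩ := hp
    -- The finitely many pairs on which the value and the application at `(a, S)` depend are
    -- entailed by a pair `(e, U)` that is itself entailed by `(a, S)`.
    set 𝔙 := τ.base ∪ baseUnion 𝒯 with h𝔙def
    have h𝔙 : 𝔙.Finite := τ.base_finite.union (baseUnion_finite hc.1)
    obtain ⟨hfin, hent⟩ := h.supp_Cl hS (h𝔙.image Prod.fst)
    obtain ⟨U, hU, hSU, hUX⟩ := h.ent_interpolation_finite hS hfin hent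
    obtain ⟨e, he, heU⟩ := h.witness_interpolation (h.finite_of_con hU) hS hSU
    have hae : 𝒜.WitEq U a e :=
      (h.witEq_of_con_singleton (h.con_singleton_of_ent he) heU).symm
    have hCl : ∀ 𝔛 ⊆ Prod.fst '' 𝔙, 𝒜.Cl a S 𝔛 ⊆ 𝒜.Cl e U 𝔛 := by
      intro 𝔛 h𝔛 p hp
      have hp' : p ∈ 𝒜.Cl a S (Prod.fst '' 𝔙) := ⟨h𝔛 hp.1, hp.2⟩
      have hUp : 𝒜.EntSet a U p.2 := fun c hcp => hUX c (subset_supp hp' hcp)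
      obtain ⟨hpX, hw, -⟩ := (h.mem_Cl_iff hS).1 hp
      exact (h.mem_Cl_iff heU).2
        ⟨hpX, (h.witEq_of_entSet (h.finite_of_con hw.con_left) hae hUp).symm.trans hw,
          fun c hcp => h.ent_of_witEq hae (hUp c hcp)⟩
    have hbase := hCl (Prod.fst '' τ.base) (Set.image_mono Set.subset_union_left)
    have hunion := hCl (Prod.fst '' baseUnion 𝒯) (Set.image_mono Set.subset_union_right)
    have w : 𝒜.WitEq (supp (𝒜.Cl a S (Prod.fst '' τ.base))) a e :=
      h.witEq_mono (supp_mono fun _ (hp : _ ∈ 𝒜.Cl a S _) =>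
        (⟨Set.image_mono Set.subset_union_left hp.1, hp.2⟩ : _ ∈ 𝒜.Cl a S (Prod.fst '' 𝔙)))
        (h.witEq_of_entSet hfin hae hUX)
    exact ⟨e, U, ⟨he, hSU⟩, heU, heU, h'.gen_subset_gen
      (h'.witEq_of_con_singleton (τ.con_wit_singleton h h' hS heU hbase w)
        (hc.con_ap h h' hS)) (ap_subset_ap subset_rfl hunion) (hc.con_ap h h' heU) ht⟩

theorem IsApproximable.ap_subset {H 𝔙 : Set ((A × Set A) × A')} (hH : IsApproximable 𝒜 𝒜' H)
    (h : 𝒜.IsInfoSys) (hVH : 𝔙 ⊆ H) {a : A} {S : Set A} (hS : 𝒜.Con a S) :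
    𝒜.ap a S 𝔙 ⊆ {t | ((a, S), t) ∈ H} := by
  rintro c ⟨p, hp, hc⟩
  obtain ⟨-, w, hent⟩ := (h.mem_Cl_iff hS).1 hp
  exact hH.mono (h.isBelow_of_entSet hS w.symm hent) (hVH hc)

theorem IsApproximable.rs_subset {H 𝔙 : Set ((A × Set A) × A')} (hH : IsApproximable 𝒜 𝒜' H)
    (h : 𝒜.IsInfoSys) (hVH : 𝔙 ⊆ H) {a : A} {S : Set A} (hS : 𝒜.Con a S) :
    𝒜.rs a S 𝔙 ⊆ {t | ((a, S), t) ∈ H} := by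
  rintro _ ⟨v, ⟨hv, w, hs⟩, rfl⟩
  exact hH.mono (h.isBelow_of_subset hS w.symm hs) (hVH hv)

theorem St_mono {H H' : Set ((A × Set A) × A')} (hs : H ⊆ H') : St 𝒜 𝒜' H ⊆ St 𝒜 𝒜' H' :=
  fun _ hβ => ⟨hβ.1.trans hs, fun a Z b hb =>
    let ⟨j, hj, w⟩ := hβ.2 a Z b hb
    ⟨j, hs hj, w⟩⟩

/-- Entailment in the function space is membership in the set of tokens of the graph. The tokens
`k` required by the definition come from interpolating a witness for the right hand sides, and all
witnesses below the value of `τ` are equivalent. -/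
theorem funEnt_iff (h : 𝒜.IsInfoSys) (h' : 𝒜'.IsInfoSys) {τ β : FunToken 𝒜 𝒜'}
    {𝒯 : Set (FunToken 𝒜 𝒜')} :
    FunEnt 𝒜 𝒜' τ 𝒯 β ↔ FunCon 𝒜 𝒜' τ 𝒯 ∧ β ∈ St 𝒜 𝒜' (graphOf τ 𝒯) := by
  have hds : ∀ a Z, 𝒜.Con a Z →
      ⋃ p ∈ 𝒜.ds a Z β.base, 𝒜.ap p.1 p.2 (baseUnion 𝒯) ⊆ 𝒜.ap a Z (baseUnion 𝒯) := by
    intro a Z hZ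
    refine Set.iUnion₂_subset ?_
    rintro _ ⟨v, ⟨-, w, hs⟩, rfl⟩
    exact (h.isBelow_of_subset hZ w.symm hs).ap_subset h
  constructor
  · rintro ⟨hc, hb, hass⟩
    refine ⟨hc, fun v hv => ⟨β.base_con v hv, hb _ _ _ hv⟩, fun a Z b hab => ?_⟩
    have hZ := (β.con_of_mem_assoc h' hab).1
    obtain ⟨k, w, hk, -⟩ := hass a Z b hab
    exact ⟨k, ⟨hZ, h'.ent_mono (h'.con_of_ent hk) (hc.con_ap h h' hZ) (hds a Z hZ) hk⟩, w.symm⟩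
  · rintro ⟨hc, hb, hass⟩
    refine ⟨hc, fun e Y f hv => (hb hv).2, fun a Z b hab => ?_⟩
    have hZ := (β.con_of_mem_assoc h' hab).1
    obtain ⟨j, ⟨-, hj⟩, w⟩ := hass a Z b hab
    have hU := h'.con_mono (hds a Z hZ) (hc.con_ap h h' hZ)
    have hrs : 𝒜'.EntSet (τ.wit a Z) (⋃ p ∈ 𝒜.ds a Z β.base, 𝒜.ap p.1 p.2 (baseUnion 𝒯))
        (𝒜.rs a Z β.base) := by
      rintro _ ⟨v, hv, rfl⟩
      have hbel := h.isBelow_of_subset hZ hv.2.1.symm hv.2.2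
      refine h'.gen_subset_gen (h'.witEq_of_con_singleton (τ.con_wit_of_isBelow h h' hbel)
        (hc.con_ap h h' hbel.witEq.con_left)) ?_ hU (hb hv.1).2
      exact Set.subset_biUnion_of_mem (u := fun p : A × Set A => 𝒜.ap p.1 p.2 (baseUnion 𝒯))
        (Set.mem_image_of_mem Prod.fst hv)
    obtain ⟨k, hk, hkc⟩ := h'.witness_interpolation (rs_finite β.base_finite) hU hrs
    exact ⟨k, w.symm.trans (witEq_of_bound w.con_left hkc (h'.con_singleton_of_ent hj)
      (h'.con_singleton_of_ent hk)), hk, hrs⟩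

/-! ### The tokens of an approximable relation -/

theorem IsApproximable.exists_mem_St {H 𝔙 : Set ((A × Set A) × A')}
    (hH : IsApproximable 𝒜 𝒜' H) (h : 𝒜.IsInfoSys) (h' : 𝒜'.IsInfoSys) (h𝔙 : 𝔙.Finite)
    (hVH : 𝔙 ⊆ H) : ∃ ε ∈ St 𝒜 𝒜' H, ε.base = 𝔙 := by
  obtain ⟨ε, rfl, hε⟩ := hH.exists_token h h' h𝔙 hVH
  exact ⟨ε, ⟨hVH, fun a Z b hb => ⟨b, hε hb, h'.witEq_refl (ε.con_of_mem_assoc h' hb).2⟩⟩, rfl⟩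

/-- The values of the tokens of an approximable relation are, up to equivalence, in the fibres. -/
theorem IsApproximable.exists_witEq_wit {H : Set ((A × Set A) × A')}
    (hH : IsApproximable 𝒜 𝒜' H) (h : 𝒜.IsInfoSys) (h' : 𝒜'.IsInfoSys) {τ : FunToken 𝒜 𝒜'}
    (hτ : τ ∈ St 𝒜 𝒜' H) {a : A} {S : Set A} (hS : 𝒜.Con a S) :
    ∃ j, ((a, S), j) ∈ H ∧ 𝒜'.WitEq (𝒜.ap a S τ.base) j (τ.wit a S) := by
  obtain ⟨e, T, hmem, hb, hrs⟩ := τ.exists_mem_assoc h h' hS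
  obtain ⟨j, hj, w⟩ := hτ.2 e T _ hmem
  exact ⟨j, hH.mono hb hj, hrs ▸ w⟩

theorem baseUnion_subset_of_subset_St {H : Set ((A × Set A) × A')} {𝒯 : Set (FunToken 𝒜 𝒜')}
    (h𝒯 : 𝒯 ⊆ St 𝒜 𝒜' H) : baseUnion 𝒯 ⊆ H :=
  Set.iUnion₂_subset fun _ hσ => (h𝒯 hσ).1

theorem IsApproximable.graphOf_subset {H : Set ((A × Set A) × A')}
    (hH : IsApproximable 𝒜 𝒜' H) (h : 𝒜.IsInfoSys) (h' : 𝒜'.IsInfoSys) {τ : FunToken 𝒜 𝒜'}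
    {𝒯 : Set (FunToken 𝒜 𝒜')} (hτ : τ ∈ St 𝒜 𝒜' H) (h𝒯 : 𝒯 ⊆ St 𝒜 𝒜' H)
    (hc : FunCon 𝒜 𝒜' τ 𝒯) : graphOf τ 𝒯 ⊆ H := by
  rintro ⟨⟨a, S⟩, t⟩ ⟨hS, ht⟩
  obtain ⟨j, hj, w⟩ := hH.exists_witEq_wit h h' hτ hS
  have w' := (hc.2 a S hS).2 j w
  exact (hH.isState hS).closed j hj _
    (hH.ap_subset h (baseUnion_subset_of_subset_St h𝒯) hS) t w'.con_left
    (h'.ent_of_witEq w'.symm ht)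

/-- Each token of an approximable relation `H` is entailed by a single token of `H`, whose base
interpolates the base of the given one in both arguments. -/
theorem IsApproximable.exists_funEnt_singleton {H : Set ((A × Set A) × A')}
    (hH : IsApproximable 𝒜 𝒜' H) (h : 𝒜.IsInfoSys) (h' : 𝒜'.IsInfoSys) {β : FunToken 𝒜 𝒜'}
    (hβ : β ∈ St 𝒜 𝒜' H) : ∃ ε ∈ St 𝒜 𝒜' H, FunEnt 𝒜 𝒜' ε {ε} β := by
  have hint : ∀ v : β.base, ∃ e Y i X, 𝒜.EntPair v.1.1.1 v.1.1.2 e Y ∧ 𝒜.Con e Y ∧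
      ((e, Y), i) ∈ H ∧ (∀ d ∈ X, ((e, Y), d) ∈ H) ∧ 𝒜'.Con i X ∧ 𝒜'.Ent i X v.1.2 := by
    rintro ⟨⟨⟨a, S⟩, t⟩, hv⟩
    obtain ⟨e, Y, hent, hY, hf⟩ := hH.interpolation (hβ.1 hv)
    obtain ⟨i, hi, X, hX, hiX, hX'⟩ := (hH.isState hY).derivable t hf
    exact ⟨e, Y, i, X, hent, hY, hi, hX, hiX, hX'⟩
  choose e Y i X hent hY hi hX hiX hX' using hint
  have : Finite β.base := β.base_finite
  obtain ⟨ε, hε, hbase⟩ := hH.exists_mem_St h h'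
    (𝔙 := ⋃ v, (fun d => ((e v, Y v), d)) '' X v)
    (Set.finite_iUnion fun v => (h'.finite_of_con (hiX v)).image _)
    (Set.iUnion_subset fun v => by rintro _ ⟨d, hd, rfl⟩; exact hX v d hd)
  have hc := funCon_self h h' ε
  have hgr : β.base ⊆ graphOf ε {ε} := by
    intro v hv
    have hS := β.base_con v hv
    have hbel := h.isBelow_of_entPair (hY ⟨v, hv⟩) (hent ⟨v, hv⟩)
    have hXap : X ⟨v, hv⟩ ⊆ 𝒜.ap v.1.1 v.1.2 ε.base := by
      intro d hd
      have hmem : ((e ⟨v, hv⟩, Y ⟨v, hv⟩), d) ∈ ε.base := by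
        rw [hbase]
        exact Set.mem_iUnion.2 ⟨⟨v, hv⟩, d, hd, rfl⟩
      exact ⟨_, (h.mem_Cl_iff hS).2
        ⟨Set.mem_image_of_mem _ hmem, hbel.witEq.symm, (hent ⟨v, hv⟩).2⟩, hmem⟩
    obtain ⟨j, hj, w⟩ := hH.exists_witEq_wit h h' hε hS
    have w' := h'.witEq_mono hXap w
    have wi := (hH.isState hS).witEq h' (hH.mono hbel (hi ⟨v, hv⟩)) hj (hiX ⟨v, hv⟩) w'.con_left
    refine ⟨hS, ?_⟩
    rw [baseUnion_singleton]
    exact h'.gen_subset_gen (wi.trans w') hXap w.con_right (hX' ⟨v, hv⟩)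
  have hA := hc.isApproximable h h'
  refine ⟨ε, hε, (funEnt_iff h h').2 ⟨hc, hgr, fun a Z b hb => ?_⟩⟩
  obtain ⟨hZ, -⟩ := β.con_of_mem_assoc h' hb
  obtain ⟨j, hj, w⟩ := hβ.2 a Z b hb
  obtain ⟨k, hk, hkc⟩ := (hA.isState hZ).consistent _ (hA.rs_subset h hgr hZ)
    (rs_finite β.base_finite)
  have hkH := hH.graphOf_subset h h' hε (Set.singleton_subset_iff.2 hε) hc hk
  exact ⟨k, hk, ((hH.isState hZ).witEq h' hkH hj hkc w.con_left).trans w⟩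

/-- A token whose base is the union of the bases of `𝒯` is a witness for the consistency of `𝒯`. -/
theorem IsApproximable.exists_funCon {H : Set ((A × Set A) × A')}
    (hH : IsApproximable 𝒜 𝒜' H) (h : 𝒜.IsInfoSys) (h' : 𝒜'.IsInfoSys)
    {𝒯 : Set (FunToken 𝒜 𝒜')} (h𝒯 : 𝒯 ⊆ St 𝒜 𝒜' H) (hfin : 𝒯.Finite) :
    ∃ ε ∈ St 𝒜 𝒜' H, FunCon 𝒜 𝒜' ε 𝒯 := by
  obtain ⟨ε, hε, hbase⟩ := hH.exists_mem_St h h' (baseUnion_finite hfin)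
    (baseUnion_subset_of_subset_St h𝒯)
  refine ⟨ε, hε, (funCon_iff h').2 ⟨hfin, fun a S hS => ⟨fun σ hσ => ?_, fun r w => ?_⟩⟩⟩
  · obtain ⟨j, hj, w⟩ := hH.exists_witEq_wit h h' (h𝒯 hσ) hS
    obtain ⟨k, hk, w'⟩ := hH.exists_witEq_wit h h' hε hS
    have w'' := h'.witEq_mono (ap_mono (hbase ▸ subset_baseUnion hσ)) w'
    exact (w.symm.trans ((hH.isState hS).witEq h' hj hk w.con_left w''.con_left)).trans w''
  · rwa [← hbase]

theorem IsApproximable.isState_St {H : Set ((A × Set A) × A')}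
    (hH : IsApproximable 𝒜 𝒜' H) (h : 𝒜.IsInfoSys) (h' : 𝒜'.IsInfoSys) :
    (funSpace h 𝒜').IsState (St 𝒜 𝒜' H) where
  consistent _ h𝒯 hfin := hH.exists_funCon h h' h𝒯 hfin
  closed τ hτ 𝒯 h𝒯 β hc hβ :=
    St_mono (hH.graphOf_subset h h' hτ h𝒯 hc) ((funEnt_iff h h').1 hβ).2
  derivable β hβ := by
    obtain ⟨ε, hε, hent⟩ := hH.exists_funEnt_singleton h h' hβ
    exact ⟨ε, hε, {ε}, Set.singleton_subset_iff.2 hε, hent.1, hent⟩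

/-! ### The function space is an information system with witnesses -/

theorem FunCon.of_subset_St (h : 𝒜.IsInfoSys) (h' : 𝒜'.IsInfoSys) {τ : FunToken 𝒜 𝒜'}
    {𝒯 𝒯' : Set (FunToken 𝒜 𝒜')} (hc : FunCon 𝒜 𝒜' τ 𝒯) (hfin : 𝒯'.Finite)
    (hs : 𝒯' ⊆ St 𝒜 𝒜' (graphOf τ 𝒯)) : FunCon 𝒜 𝒜' τ 𝒯' := by
  have hA := hc.isApproximable h h'
  refine (funCon_iff h').2 ⟨hfin, fun a S hS => ⟨fun σ hσ => ?_, fun r w => ?_⟩⟩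
  · obtain ⟨j, hj, w⟩ := hA.exists_witEq_wit h h' (hs hσ) hS
    exact w.symm.trans (h'.witEq_of_con_singleton (h'.con_singleton_of_ent hj.2) w.con_left)
  · have w' := ((hc.2 a S hS).2 r w).symm
    exact (h'.witEq_of_entSet (ap_finite (baseUnion_finite hfin)) w' fun t ht =>
      (hA.ap_subset h (baseUnion_subset_of_subset_St hs) hS ht).2).symm

theorem FunCon.transfer (h' : 𝒜'.IsInfoSys) {τ β : FunToken 𝒜 𝒜'} {𝒯 : Set (FunToken 𝒜 𝒜')}
    (hτβ : FunCon 𝒜 𝒜' τ {β}) (hc : FunCon 𝒜 𝒜' β 𝒯) : FunCon 𝒜 𝒜' τ 𝒯 := by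
  rw [funCon_iff h'] at hτβ hc ⊢
  refine ⟨hc.1, fun a S hS => ?_⟩
  obtain ⟨h1, h2⟩ := hτβ.2 a S hS
  obtain ⟨h3, h4⟩ := hc.2 a S hS
  rw [baseUnion_singleton] at h2
  have w := h1 β rfl
  have w' := h4 _ w.symm
  refine ⟨fun σ hσ => (h3 σ hσ).trans ?_, fun r hr =>
    (h4 r ((h2 r hr).trans w.symm)).trans w'.symm⟩
  exact h'.witEq_mono (ap_mono (subset_baseUnion hσ)) w'.symm

theorem graphOf_eq_of_funCon (h' : 𝒜'.IsInfoSys) {τ β : FunToken 𝒜 𝒜'}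
    {𝒯 : Set (FunToken 𝒜 𝒜')} (hτβ : FunCon 𝒜 𝒜' τ {β}) (hc : FunCon 𝒜 𝒜' β 𝒯) :
    graphOf τ 𝒯 = graphOf β 𝒯 := by
  rw [funCon_iff h'] at hτβ hc
  ext ⟨⟨a, S⟩, t⟩
  refine and_congr_right fun hS => ?_
  have w := (hc.2 a S hS).2 _ ((hτβ.2 a S hS).1 β rfl).symm
  exact ⟨h'.ent_of_witEq w, h'.ent_of_witEq w.symm⟩

theorem FunCon.graphOf_subset_of_subset (h : 𝒜.IsInfoSys) (h' : 𝒜'.IsInfoSys)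
    {τ : FunToken 𝒜 𝒜'} {𝒯 𝒯' : Set (FunToken 𝒜 𝒜')} (hc : FunCon 𝒜 𝒜' τ 𝒯)
    (hc' : FunCon 𝒜 𝒜' τ 𝒯') (hs : 𝒯 ⊆ 𝒯') : graphOf τ 𝒯 ⊆ graphOf τ 𝒯' := by
  rintro ⟨⟨a, S⟩, t⟩ ⟨hS, ht⟩
  exact ⟨hS, h'.ent_mono (hc.con_ap h h' hS) (hc'.con_ap h h' hS)
    (ap_mono (baseUnion_mono hs)) ht⟩

theorem FunCon.graphOf_subset_of_subset_St (h : 𝒜.IsInfoSys) (h' : 𝒜'.IsInfoSys)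
    {τ : FunToken 𝒜 𝒜'} {𝒯 𝒯' : Set (FunToken 𝒜 𝒜')} (hc : FunCon 𝒜 𝒜' τ 𝒯) (hfin : 𝒯'.Finite)
    (hs : 𝒯' ⊆ St 𝒜 𝒜' (graphOf τ 𝒯)) : graphOf τ 𝒯' ⊆ graphOf τ 𝒯 := by
  rintro ⟨⟨a, S⟩, t⟩ ⟨hS, ht⟩
  exact ⟨hS, h'.ent_trans (ap_finite (baseUnion_finite hfin)) (hc.con_ap h h' hS)
    (fun c hct => ((hc.isApproximable h h').ap_subset h (baseUnion_subset_of_subset_St hs)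
      hS hct).2) ht⟩

theorem IsInfoSys.funSpace (h : 𝒜.IsInfoSys) (h' : 𝒜'.IsInfoSys) :
    (InfoFrame.funSpace h 𝒜').IsInfoSys where
  finite_of_con hc := hc.1
  con_of_ent hent := hent.1
  con_self τ := funCon_self h h' τ
  con_mono {τ 𝒯 𝒯'} hs hc := by
    refine ⟨hc.1.subset hs, fun a S hS => ⟨fun σ hσ => (hc.2 a S hS).1 σ (hs hσ), fun r w => ?_⟩⟩
    exact h'.witEq_mono (ap_mono (baseUnion_mono hs)) ((hc.2 a S hS).2 r w)
  ent_truth τ := by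
    have hc : FunCon 𝒜 𝒜' τ ∅ := by
      refine ⟨Set.finite_empty, fun a S hS => ⟨fun σ hσ => hσ.elim, fun r w => ?_⟩⟩
      refine h'.witEq_mono ?_ w
      exact ap_mono (Set.iUnion₂_subset fun σ hσ => hσ.elim)
    refine (funEnt_iff h h').2 ⟨hc, fun v hv => hv.elim, fun a Z b hb => ?_⟩
    have hcb := FunToken.con_of_mem_assoc h' hb
    obtain ⟨⟨rfl, rfl⟩, rfl⟩ : (a = 𝒜.truth ∧ Z = ∅) ∧ b = 𝒜'.truth := by
      simpa only [Prod.mk.injEq] using (show ((a, Z), b) = ((𝒜.truth, ∅), 𝒜'.truth) from hb)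
    exact ⟨𝒜'.truth, ((hc.isApproximable h h').isState hcb.1).truth_mem h', h'.witEq_refl hcb.2⟩
  con_of_entSet {τ 𝒯 𝒯'} hfin hc hent :=
    FunCon.of_subset_St h h' hc hfin fun β hβ => ((funEnt_iff h h').1 (hent β hβ)).2
  ent_mono {τ 𝒯 𝒯' β} hc hc' hs hent := (funEnt_iff h h').2
    ⟨hc', St_mono (FunCon.graphOf_subset_of_subset h h' hc hc' hs) ((funEnt_iff h h').1 hent).2⟩
  ent_trans {τ 𝒯 𝒯' β} hfin hc hent hβ := (funEnt_iff h h').2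
    ⟨hc, St_mono (FunCon.graphOf_subset_of_subset_St h h' hc hfin
      fun σ hσ => ((funEnt_iff h h').1 (hent σ hσ)).2) ((funEnt_iff h h').1 hβ).2⟩
  ent_interpolation {τ 𝒯 β} hent := by
    obtain ⟨hc, hβ⟩ := (funEnt_iff h h').1 hent
    obtain ⟨ε, hε, hεβ⟩ := (hc.isApproximable h h').exists_funEnt_singleton h h' hβ
    obtain ⟨hcε, hβε⟩ := (funEnt_iff h h').1 hεβ
    have hτε : FunCon 𝒜 𝒜' τ {ε} :=
      hc.of_subset_St h h' (Set.finite_singleton _) (Set.singleton_subset_iff.2 hε)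
    refine ⟨{ε}, hτε, ?_, (funEnt_iff h h').2 ⟨hτε, ?_⟩⟩
    · rintro σ rfl
      exact (funEnt_iff h h').2 ⟨hc, hε⟩
    · rwa [graphOf_eq_of_funCon h' hτε hcε]
  witness_interpolation {τ 𝒯 𝒯'} hfin hc hent := by
    obtain ⟨ε, hε, hcε⟩ := (FunCon.isApproximable hc h h').exists_funCon h h'
      (fun β hβ => ((funEnt_iff h h').1 (hent β hβ)).2) hfin
    exact ⟨ε, (funEnt_iff h h').2 ⟨hc, hε⟩, hcε⟩
  con_transfer {β τ 𝒯} hτβ hc := FunCon.transfer h' hτβ hc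
  ent_transfer {β τ 𝒯 γ} hτβ hc hent := by
    refine (funEnt_iff h h').2 ⟨FunCon.transfer h' hτβ hc, ?_⟩
    rw [graphOf_eq_of_funCon h' hτβ hc]
    exact ((funEnt_iff h h').1 hent).2
  ent_conservative {β τ 𝒯 γ} hτβ hc hent := by
    refine (funEnt_iff h h').2 ⟨hc, ?_⟩
    rw [← graphOf_eq_of_funCon h' hτβ hc]
    exact ((funEnt_iff h h').1 hent).2

/-! ### States of the function space and approximable relations -/

section StateOfFunSpace

variable {f : Set (FunToken 𝒜 𝒜')}

/-- If `(τ, 𝒯)` lies in `f`, then a token of `f` with base `{v}` exists for each `v` in the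
graph. -/
theorem graphOf_subset_am (h : 𝒜.IsInfoSys) (h' : 𝒜'.IsInfoSys) (hf : (funSpace h 𝒜').IsState f)
    {τ : FunToken 𝒜 𝒜'} {𝒯 : Set (FunToken 𝒜 𝒜')} (hτ : τ ∈ f) (h𝒯 : 𝒯 ⊆ f)
    (hc : FunCon 𝒜 𝒜' τ 𝒯) : graphOf τ 𝒯 ⊆ am f := by
  intro v hv
  obtain ⟨ε, hε, hbase⟩ := (hc.isApproximable h h').exists_mem_St h h' (Set.finite_singleton v)
    (Set.singleton_subset_iff.2 hv)
  have hεf : ε ∈ f := hf.closed τ hτ 𝒯 h𝒯 ε hc ((funEnt_iff h h').2 ⟨hc, hε⟩)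
  exact subset_baseUnion hεf (hbase ▸ Set.mem_singleton v)

theorem exists_subset_St_graphOf (h : 𝒜.IsInfoSys) (h' : 𝒜'.IsInfoSys)
    (hf : (funSpace h 𝒜').IsState f) {𝒢 : Set (FunToken 𝒜 𝒜')} (hfin : 𝒢.Finite) (h𝒢 : 𝒢 ⊆ f) :
    ∃ τ ∈ f, ∃ 𝒯 ⊆ f, FunCon 𝒜 𝒜' τ 𝒯 ∧ 𝒢 ⊆ St 𝒜 𝒜' (graphOf τ 𝒯) := by
  obtain ⟨τ, hτ, 𝒯, h𝒯, hc, hent⟩ := hf.exists_entSet (h.funSpace h') hfin h𝒢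
  exact ⟨τ, hτ, 𝒯, h𝒯, hc, fun σ hσ => ((funEnt_iff h h').1 (hent σ hσ)).2⟩

/-- The relation of a state `f` is the directed union of the graphs of the pairs inside `f`. -/
theorem exists_subset_graphOf (h : 𝒜.IsInfoSys) (h' : 𝒜'.IsInfoSys)
    (hf : (funSpace h 𝒜').IsState f) {𝔙 : Set ((A × Set A) × A')} (hfin : 𝔙.Finite)
    (h𝔙 : 𝔙 ⊆ am f) : ∃ τ ∈ f, ∃ 𝒯 ⊆ f, FunCon 𝒜 𝒜' τ 𝒯 ∧ 𝔙 ⊆ graphOf τ 𝒯 := by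
  have hex : ∀ v : 𝔙, ∃ σ ∈ f, v.1 ∈ σ.base := fun v => by simpa [am, baseUnion] using h𝔙 v.2
  choose σ hσ hv using hex
  have : Finite 𝔙 := hfin
  obtain ⟨τ, hτ, 𝒯, h𝒯, hc, hs⟩ := exists_subset_St_graphOf h h' hf (Set.finite_range σ)
    (Set.range_subset_iff.2 hσ)
  exact ⟨τ, hτ, 𝒯, h𝒯, hc, fun v hv' => (hs (Set.mem_range_self ⟨v, hv'⟩)).1 (hv ⟨v, hv'⟩)⟩

theorem isApproximable_am (h : 𝒜.IsInfoSys) (h' : 𝒜'.IsInfoSys)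
    (hf : (funSpace h 𝒜').IsState f) : IsApproximable 𝒜 𝒜' (am f) := by
  have hone : ∀ {v}, v ∈ am f → ∃ τ ∈ f, ∃ 𝒯 ⊆ f, FunCon 𝒜 𝒜' τ 𝒯 ∧ v ∈ graphOf τ 𝒯 := by
    intro v hv
    obtain ⟨τ, hτ, 𝒯, h𝒯, hc, hs⟩ := exists_subset_graphOf h h' hf (Set.finite_singleton v)
      (Set.singleton_subset_iff.2 hv)
    exact ⟨τ, hτ, 𝒯, h𝒯, hc, hs rfl⟩
  have hfib : ∀ {a S} {F : Set A'}, F.Finite → F ⊆ {t | ((a, S), t) ∈ am f} →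
      ∃ τ ∈ f, ∃ 𝒯 ⊆ f, FunCon 𝒜 𝒜' τ 𝒯 ∧ F ⊆ {t | ((a, S), t) ∈ graphOf τ 𝒯} := by
    intro a S F hF hs
    obtain ⟨τ, hτ, 𝒯, h𝒯, hc, hs'⟩ := exists_subset_graphOf h h' hf (hF.image fun t => ((a, S), t))
      (Set.image_subset_iff.2 hs)
    exact ⟨τ, hτ, 𝒯, h𝒯, hc, Set.image_subset_iff.1 hs'⟩
  refine ⟨fun hv => ?_, fun hb hv => ?_, fun {a S} hS => ⟨fun F hF hfin => ?_,
    fun i hi X hX t hc ht => ?_, fun t ht => ?_⟩, fun hv => ?_⟩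
  · obtain ⟨τ, hτ, 𝒯, h𝒯, hc, hv⟩ := hone hv
    exact hv.1
  · obtain ⟨τ, hτ, 𝒯, h𝒯, hc, hv⟩ := hone hv
    exact graphOf_subset_am h h' hf hτ h𝒯 hc ((hc.isApproximable h h').mono hb hv)
  · obtain ⟨τ, hτ, 𝒯, h𝒯, hc, hs⟩ := hfib hfin hF
    obtain ⟨j, hj, hjF⟩ := ((hc.isApproximable h h').isState hS).consistent F hs hfin
    exact ⟨j, graphOf_subset_am h h' hf hτ h𝒯 hc hj, hjF⟩
  · obtain ⟨τ, hτ, 𝒯, h𝒯, hcT, hs⟩ := hfib ((h'.finite_of_con hc).insert i)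
      (Set.insert_subset hi hX)
    exact graphOf_subset_am h h' hf hτ h𝒯 hcT
      (((hcT.isApproximable h h').isState hS).closed i (hs (Set.mem_insert _ _)) X
        ((Set.subset_insert _ _).trans hs) t hc ht)
  · obtain ⟨τ, hτ, 𝒯, h𝒯, hc, hv⟩ := hone ht
    obtain ⟨i, hi, X, hX, hiX, he⟩ := ((hc.isApproximable h h').isState hS).derivable t hv
    have hs := graphOf_subset_am h h' hf hτ h𝒯 hc
    exact ⟨i, hs hi, X, fun d hd => hs (hX hd), hiX, he⟩
  · obtain ⟨τ, hτ, 𝒯, h𝒯, hc, hv⟩ := hone hv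
    obtain ⟨e, Y, hent, hY, hv'⟩ := (hc.isApproximable h h').interpolation hv
    exact ⟨e, Y, hent, hY, graphOf_subset_am h h' hf hτ h𝒯 hc hv'⟩

theorem IsApproximable.am_St {H : Set ((A × Set A) × A')} (hH : IsApproximable 𝒜 𝒜' H)
    (h : 𝒜.IsInfoSys) (h' : 𝒜'.IsInfoSys) : am (St 𝒜 𝒜' H) = H := by
  refine (baseUnion_subset_of_subset_St subset_rfl).antisymm fun v hv => ?_
  obtain ⟨ε, hε, hbase⟩ := hH.exists_mem_St h h' (Set.finite_singleton v)
    (Set.singleton_subset_iff.2 hv)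
  exact subset_baseUnion hε (hbase ▸ Set.mem_singleton v)

/-- A state of the function space is determined by its relation. -/
theorem St_am (h : 𝒜.IsInfoSys) (h' : 𝒜'.IsInfoSys) (hf : (funSpace h 𝒜').IsState f) :
    St 𝒜 𝒜' (am f) = f := by
  refine subset_antisymm (fun β hβ => ?_) fun β hβ => ?_
  · -- One pair `(τ, 𝒯)` covers the finite base of `β`. The associate of `β` may be infinite; for
    -- each of its members a witness from the graph is compared with `j` inside a fibre of `am f`.
    obtain ⟨τ, hτ, 𝒯, h𝒯, hc, hb⟩ := exists_subset_graphOf h h' hf β.base_finite hβ.1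
    refine hf.closed τ hτ 𝒯 h𝒯 β hc ((funEnt_iff h h').2 ⟨hc, hb, fun a Z b hab => ?_⟩)
    have hA := hc.isApproximable h h'
    obtain ⟨hZ, -⟩ := β.con_of_mem_assoc h' hab
    obtain ⟨j, hj, w⟩ := hβ.2 a Z b hab
    obtain ⟨k, hk, hkc⟩ := (hA.isState hZ).consistent _ (hA.rs_subset h hb hZ)
      (rs_finite β.base_finite)
    have hkf := graphOf_subset_am h h' hf hτ h𝒯 hc hk
    exact ⟨k, hk,
      (((isApproximable_am h h' hf).isState hZ).witEq h' hkf hj hkc w.con_left).trans w⟩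
  · obtain ⟨τ, hτ, 𝒯, h𝒯, hc, hs⟩ := exists_subset_St_graphOf h h' hf (Set.finite_singleton β)
      (Set.singleton_subset_iff.2 hβ)
    exact St_mono (graphOf_subset_am h h' hf hτ h𝒯 hc) (hs rfl)

end StateOfFunSpace

/-! ### Approximable relations and Scott continuous functions -/

section Apply

variable {H : Set ((A × Set A) × A')}

theorem IsApproximable.exists_subset_fibre (hH : IsApproximable 𝒜 𝒜' H) (h : 𝒜.IsInfoSys)
    {x : Set A} (hx : 𝒜.IsState x) {F : Set A'} (hF : F.Finite) (hFx : F ⊆ 𝒜.applyRel H x) :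
    ∃ i ∈ x, ∃ X ⊆ x, 𝒜.Con i X ∧ F ⊆ {t | ((i, X), t) ∈ H} := by
  choose i X hc hsub hH' using fun b : F => hFx b.2
  have : Finite F := hF
  obtain ⟨k, hk, hkc⟩ := hx.consistent (⋃ b, insert (i b) (X b)) (Set.iUnion_subset hsub)
    (Set.finite_iUnion fun b => (h.finite_of_con (hc b)).insert _)
  refine ⟨k, hk, _, Set.iUnion_subset hsub, hkc, fun b hb => ?_⟩
  have hle : insert (i ⟨b, hb⟩) (X ⟨b, hb⟩) ⊆ ⋃ b, insert (i b) (X b) :=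
    Set.subset_iUnion (fun b => insert (i b) (X b)) ⟨b, hb⟩
  have hki : 𝒜.Con k {i ⟨b, hb⟩} :=
    h.con_mono (Set.singleton_subset_iff.2 (hle (Set.mem_insert _ _))) hkc
  exact hH.mono (h.isBelow_of_subset hkc (h.witEq_of_con_singleton hki (hc ⟨b, hb⟩))
    ((Set.subset_insert _ _).trans hle)) (hH' ⟨b, hb⟩)

theorem IsApproximable.isState_applyRel (hH : IsApproximable 𝒜 𝒜' H) (h : 𝒜.IsInfoSys)
    (h' : 𝒜'.IsInfoSys) {x : Set A} (hx : 𝒜.IsState x) : 𝒜'.IsState (𝒜.applyRel H x) := by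
  have hfib : ∀ {i X}, i ∈ x → X ⊆ x → 𝒜.Con i X → {t | ((i, X), t) ∈ H} ⊆ 𝒜.applyRel H x :=
    fun hi hX hc t ht => ⟨_, _, hc, Set.insert_subset hi hX, ht⟩
  refine ⟨fun F hF hfin => ?_, fun j hj Y hY t hc ht => ?_, fun t ht => ?_⟩
  · obtain ⟨i, hi, X, hX, hiX, hs⟩ := hH.exists_subset_fibre h hx hfin hF
    obtain ⟨j, hj, hjF⟩ := (hH.isState hiX).consistent F hs hfin
    exact ⟨j, hfib hi hX hiX hj, hjF⟩
  · obtain ⟨i, hi, X, hX, hiX, hs⟩ := hH.exists_subset_fibre h hx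
      ((h'.finite_of_con hc).insert j) (Set.insert_subset hj hY)
    exact hfib hi hX hiX ((hH.isState hiX).closed j (hs (Set.mem_insert _ _)) Y
      ((Set.subset_insert _ _).trans hs) t hc ht)
  · obtain ⟨i, X, hiX, hsub, htH⟩ := ht
    obtain ⟨j, hj, Y, hY, hjY, he⟩ := (hH.isState hiX).derivable t htH
    have hs := hfib (hsub (Set.mem_insert _ _)) ((Set.subset_insert _ _).trans hsub) hiX
    exact ⟨j, hs hj, Y, hY.trans hs, hjY, he⟩

theorem IsApproximable.scottContinuous (hH : IsApproximable 𝒜 𝒜' H) (h : 𝒜.IsInfoSys)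
    (h' : 𝒜'.IsInfoSys) : ScottContinuous (fun x : 𝒜.State =>
      (⟨𝒜.applyRel H x.1, hH.isState_applyRel h h' x.2⟩ : 𝒜'.State)) := by
  intro S hne hd s hs
  constructor
  · rintro _ ⟨x, hx, rfl⟩ b ⟨i, X, hc, hsub, hb⟩
    exact ⟨i, X, hc, hsub.trans (hs.1 hx), hb⟩
  · rintro y hy b ⟨i, X, hc, hsub, hb⟩
    obtain ⟨x, hx, hsub'⟩ := h.exists_subset_of_isLUB hne hd hs
      ((h.finite_of_con hc).insert i) hsub
    exact hy ⟨x, hx, rfl⟩ ⟨i, X, hc, hsub', hb⟩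

/-- An approximable relation is recovered from its function; this uses interpolation. -/
theorem IsApproximable.relOf_applyRel (hH : IsApproximable 𝒜 𝒜' H) (h : 𝒜.IsInfoSys)
    {g : 𝒜.State → 𝒜'.State} (hg : ∀ x, (g x).1 = 𝒜.applyRel H x.1) : relOf h g = H := by
  ext ⟨⟨a, S⟩, t⟩
  constructor
  · rintro ⟨hS, ht⟩
    dsimp only at hS ht
    rw [hg] at ht
    obtain ⟨i, X, hiX, hsub, htH⟩ := ht
    exact hH.mono (h.isBelow_of_entPair hiX ⟨hsub (Set.mem_insert _ _),
      fun c hc => hsub (Set.mem_insert_of_mem _ hc)⟩) htH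
  · intro ht
    refine ⟨hH.con ht, ?_⟩
    dsimp only
    rw [hg]
    obtain ⟨e, Y, hent, hY, ht'⟩ := hH.interpolation ht
    exact ⟨e, Y, hY, Set.insert_subset hent.1 hent.2, ht'⟩

end Apply

/-- A Scott continuous function is determined by its values at the states `[X]_i`. -/
theorem exists_mem_gen_of_mem (h : 𝒜.IsInfoSys) (h' : 𝒜'.IsInfoSys) {g : 𝒜.State → 𝒜'.State}
    (hg : ScottContinuous g) (x : 𝒜.State) {b : A'} (hb : b ∈ (g x).1) :
    ∃ i X, ∃ hX : 𝒜.Con i X, i ∈ x.1 ∧ X ⊆ x.1 ∧ b ∈ (g ⟨𝒜.gen i X, h.isState_gen hX⟩).1 := by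
  have hd := genSet_directed h x
  have hlub := hg (genSet_nonempty h x) hd (genSet_isLUB h x)
  obtain ⟨_, ⟨_, ⟨i, X, hX, hi, hXx, rfl⟩, rfl⟩, hbi⟩ := h'.exists_subset_of_isLUB
    ((genSet_nonempty h x).image g) (hd.mono_comp fun _ _ hab => hg.monotone hab) hlub
    (Set.finite_singleton b) (Set.singleton_subset_iff.2 hb)
  exact ⟨i, X, hX, hi, hXx, hbi rfl⟩

theorem isApproximable_relOf (h : 𝒜.IsInfoSys) (h' : 𝒜'.IsInfoSys) {g : 𝒜.State → 𝒜'.State}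
    (hg : ScottContinuous g) : IsApproximable 𝒜 𝒜' (relOf h g) where
  con hv := hv.1
  mono hb hv := ⟨hb.con, hg.monotone
    (show (⟨_, h.isState_gen hv.1⟩ : 𝒜.State) ≤ ⟨_, h.isState_gen hb.con⟩ from hb.gen_subset) hv.2⟩
  isState {a S} hS := by
    have : {t | ((a, S), t) ∈ relOf h g} = (g ⟨𝒜.gen a S, h.isState_gen hS⟩).1 :=
      Set.ext fun t => ⟨fun ht => ht.2, fun ht => ⟨hS, ht⟩⟩
    rw [this]
    exact (g _).2
  interpolation {a S t} hv := by
    obtain ⟨i, X, hX, hi, hXS, ht⟩ := exists_mem_gen_of_mem h h' hg _ hv.2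
    exact ⟨i, X, ⟨hi, hXS⟩, hX, hX, ht⟩

theorem applyRel_relOf (h : 𝒜.IsInfoSys) (h' : 𝒜'.IsInfoSys) {g : 𝒜.State → 𝒜'.State}
    (hg : ScottContinuous g) (x : 𝒜.State) : 𝒜.applyRel (relOf h g) x.1 = (g x).1 := by
  refine subset_antisymm ?_ fun b hb => ?_
  · rintro b ⟨i, X, -, hsub, hX, hb⟩
    have hle : (⟨𝒜.gen i X, h.isState_gen hX⟩ : 𝒜.State) ≤ x :=
      x.2.gen_subset h (hsub (Set.mem_insert _ _)) ((Set.subset_insert _ _).trans hsub)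
    exact hg.monotone hle hb
  · obtain ⟨i, X, hX, hi, hXx, hb'⟩ := exists_mem_gen_of_mem h h' hg x hb
    exact ⟨i, X, hX, Set.insert_subset hi hXx, hX, hb'⟩

/-! ### The isomorphism -/

/-- The order isomorphism given by `fct` and `st`, through approximable relations. -/
def funSpaceIso (h : 𝒜.IsInfoSys) (h' : 𝒜'.IsInfoSys) :
    (funSpace h 𝒜').State ≃o ScottMap 𝒜.State 𝒜'.State :=
  Equiv.toOrderIso
    { toFun := fun f => ⟨fun x => ⟨fct f.1 x.1,
          (isApproximable_am h h' f.2).isState_applyRel h h' x.2⟩,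
        (isApproximable_am h h' f.2).scottContinuous h h'⟩
      invFun := fun g => ⟨st h g.1, (isApproximable_relOf h h' g.2).isState_St h h'⟩
      left_inv := fun f => by
        refine Subtype.ext ?_
        dsimp only [st]
        rw [(isApproximable_am h h' f.2).relOf_applyRel h fun x => rfl]
        exact St_am h h' f.2
      right_inv := fun g => by
        refine Subtype.ext (funext fun x => Subtype.ext ?_)
        dsimp only [st, fct]
        rw [(isApproximable_relOf h h' g.2).am_St h h']
        exact applyRel_relOf h h' g.2 x }
    (by
      rintro f f' hff x b ⟨i, X, hc, hsub, hb⟩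
      exact ⟨i, X, hc, hsub, baseUnion_mono hff hb⟩)
    (by
      intro g g' hgg
      exact St_mono fun v hv => ⟨hv.1, hgg _ hv.2⟩)

end InfoFrame

theorem mainTheorem5 {A : Type u} {A' : Type v} (𝒜 : InfoFrame A) (𝒜' : InfoFrame A')
    (h : 𝒜.IsInfoSys) (h' : 𝒜'.IsInfoSys) :
    (InfoFrame.funSpace h 𝒜').IsInfoSys ∧
    IsContinuousDomain (InfoFrame.funSpace h 𝒜').State ∧
    IsContinuousDomain (ScottMap 𝒜.State 𝒜'.State) ∧
    ∃ Φ : (InfoFrame.funSpace h 𝒜').State ≃o ScottMap 𝒜.State 𝒜'.State,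
      (∀ (f : (InfoFrame.funSpace h 𝒜').State) (x : 𝒜.State),
        ((Φ f).1 x).1 = InfoFrame.fct f.1 x.1) ∧
      (∀ g : ScottMap 𝒜.State 𝒜'.State, (Φ.symm g).1 = InfoFrame.st h g.1) ∧
      ScottContinuous Φ ∧ ScottContinuous Φ.symm := by
  have hF := h.funSpace h'
  exact ⟨hF, hF.isContinuousDomain, hF.isContinuousDomain.orderIso (InfoFrame.funSpaceIso h h'),
    InfoFrame.funSpaceIso h h', fun _ _ => rfl, fun _ => rfl,
    (InfoFrame.funSpaceIso h h').scottContinuous_coe,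
    (InfoFrame.funSpaceIso h h').symm.scottContinuous_coe⟩
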